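/- **Conventions.** All 2-categories are strict, and all categories, 2-categories and $\mathscr F$-categories below are small, unless said otherwise. *Enhanced 2-categories.* Let $\mathscr F$ be the category whose objects are full embeddings $A\colon A_\tau\hookrightarrow A_\lambda$ of small categories (fully faithful functors that are injective on objects) and whose morphisms are commuting squares of functors. It is cartesian closed. An $\mathscr F$-category $\mathbb A$ is a category enriched in $\mathscr F$, that is, a 2-category whose 1-cells are called *loose morphisms*, with a wide and locally full sub-2-category whose 1-cells are called *tight*. An $\mathscr F$-functor is a 2-functor that preserves tightness; an $\mathscr F$-natural transformation is a 2-natural transformation with tight components. Write $\mathbb F$ for the (large) $\mathscr F$-category of full embeddings: its loose morphisms $A\to B$ are the functors $A_\lambda\to B_\lambda$, its tight morphisms are those that restrict to functors $A_\tau\to B_\tau$, and its 2-cells are natural transformations. The hom $\mathbb A(X,Y)\in\mathbb F$ is the category of loose morphisms $X\to Y$ with its full subcategory of tight ones. For $\mathscr F$-functors $U,V\colon\mathbb J\to\mathbb F$ write $[\mathbb J,\mathbb F](U,V)\in\mathbb F$ for the category of 2-natural transformations and modifications, the tight objects being the transformations with tight components. *Weaknesses.* Let $\mathscr W=\{s,p,l,c\}$,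 with the partial order generated by $s\le p$, $p\le l$, $p\le c$, and the involution $\overline s=s$, $\overline p=p$, $\overline l=c$, $\overline c=l$. In a square of 1-cells with upper-right composite $f$ and lower-left composite $g$, an $l$-cell is a 2-cell $f\Rightarrow g$, a $c$-cell is a 2-cell $g\Rightarrow f$, a $p$-cell is an invertible $l$-cell, and an $s$-cell is an identity 2-cell. *Functor $\mathscr F$-categories.* Let $w'\le w$ in $\mathscr W$ and let $\mathbb S,\mathbb C$ be $\mathscr F$-categories. The $\mathscr F$-category $\mathbf{Fun}_{w',w}(\mathbb S,\mathbb C)$ has as objects the $\mathscr F$-functors $\mathbb S\to\mathbb C$. A loose morphism $\phi\colon M\to N$ consists of loose morphisms $\phi_S\colon M(S)\to N(S)$ for $S\in\mathbb S$ and, for each loose $s\colon S\to S'$, a $w$-cell $\phi_s$ in the square with composites $N(s)\phi_S$ (upper-right) and $\phi_{S'}M(s)$ (lower-left), natural in the 2-cells of $\mathbb S$ and compatible with identities and composition, such that $\phi_s$ is a $w'$-cell whenever $s$ is tight. It is tight if every $\phi_S$ is tight and every $\phi_s$ is a $w'$-cell. The 2-cells are modifications. *Weights and limits.* An $\mathscr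 F$-weight is an $\mathscr F$-functor $W\colon\mathbb J\to\mathbb F$ with $\mathbb J$ small. A weighted cone in $\mathbb C$ is a tuple $(W,D,X,\gamma)$ with $W\colon\mathbb J\to\mathbb F$ a weight, $D\colon\mathbb J\to\mathbb C$ an $\mathscr F$-functor, $X\in\mathbb C$, and $\gamma\colon W\Rightarrow\mathbb C(X,D-)$ an $\mathscr F$-natural transformation. An $\mathscr F$-functor $G\colon\mathbb C\to\mathbb E$ sends it to the weighted cone $(W,GD,GX,G_{X,D-}\circ\gamma)$ in $\mathbb E$. It is a (weighted) limit cone if, for each $A\in\mathbb C$, the induced morphism $\mathbb C(A,X)\to[\mathbb J,\mathbb F](W,\mathbb C(A,D-))$ is invertible in $\mathscr F$. For a class $\Psi$ of weights, a $\Psi$-limit cone is a limit cone whose weight is in $\Psi$; $\mathbb C$ is $\Psi$-complete if every $D\colon\mathbb J\to\mathbb C$ has a $W$-weighted limit cone for each $W\colon\mathbb J\to\mathbb F$ in $\Psi$. *Sketches and models.* A (limit) $\mathscr F$-sketch $\mathcal S$ is an $\mathscr F$-category $\mathbb S$ with a class of weighted cones in $\mathbb S$; it is a $\Psi$-limit $\mathscr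 F$-sketch if all their weights are in $\Psi$. A model of $\mathcal S$ in a sketch $\mathcal C$ is an $\mathscr F$-functor $\mathbb S\to\mathbb C$ that sends the cones of $\mathcal S$ to cones of $\mathcal C$, and $\mathbf{Mod}_{w',w}(\mathcal S,\mathcal C)$ is the full sub-$\mathscr F$-category of $\mathbf{Fun}_{w',w}(\mathbb S,\mathbb C)$ on the models. A $\Psi$-complete $\mathscr F$-category $\mathbb C$ is regarded as the $\Psi$-limit sketch whose cones are all the $\Psi$-limit cones in $\mathbb C$; thus, for a $\Psi$-limit sketch $\mathcal S$, the objects of $\mathbf{Mod}_{w',w}(\mathcal S,\mathbb C)$ are the $\mathscr F$-functors $\mathbb S\to\mathbb C$ that send the specified weighted cones to weighted limit cones. *Creation.* A class $\Psi$ of $\mathscr F$-weights is $(w',w)$-created if, for every $\Psi$-limit $\mathscr F$-sketch $\mathcal S$ and every $\Psi$-complete $\mathscr F$-category $\mathbb C$, the $\mathscr F$-category $\mathbf{Mod}_{w',w}(\mathcal S,\mathbb C)$ is $\Psi$-complete, and the evaluation $\mathscr F$-functors $\mathbf{Mod}_{w',w}(\mathcal S,\mathbb C)\to\mathbb C$,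 $M\mapsto M(S)$, for $S\in\mathbb S$, preserve and jointly reflect $\Psi$-limits: a weighted cone in $\mathbf{Mod}_{w',w}(\mathcal S,\mathbb C)$ with weight in $\Psi$ is a limit cone if and only if all of its images under the evaluation $\mathscr F$-functors are limit cones. **Theorem.** Let $w'\le w$ be weaknesses, and let $\Psi$ be a class of $\mathscr F$-weights that is both $(w',w)$-created and $(\overline{w'},\overline w)$-created. Let $\mathcal S$ and $\mathcal T$ be $\Psi$-limit $\mathscr F$-sketches and let $\mathbb C$ be a $\Psi$-complete $\mathscr F$-category. Then $$\mathbf{Mod}_{w',w}\bigl(\mathcal S,\mathbf{Mod}_{\overline{w'},\overline w}(\mathcal T,\mathbb C)\bigr)\quad\text{and}\quad\mathbf{Mod}_{\overline{w'},\overline w}\bigl(\mathcal T,\mathbf{Mod}_{w',w}(\mathcal S,\mathbb C)\bigr)$$ are $\Psi$-complete $\mathscr F$-categories, and they are isomorphic as $\mathscr F$-categories (there are mutually inverse $\mathscr F$-functors between them). -/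

import Mathlib

open CategoryTheory Bicategory

universe w₁ w₂ w₃ w₄ v₁ v₂ v₃ v₄ u u₁ u₂ u₃ u₄

namespace Enhanced

/-! ## Weaknesses -/

/-- The weaknesses: strict, pseudo, lax and colax. -/
inductive Weakness
  | s | p | l | c

namespace Weakness

/-- The involution exchanging lax and colax. -/
def dual : Weakness → Weakness
  | s => s
  | p => p
  | l => c
  | c => l

/-- The partial order generated by `s ≤ p`, `p ≤ l`, `p ≤ c`. -/
protected def le : Weakness → Weakness → Prop
  | s, _ => True
  | p, p | p, l | p, c => True
  | l, l => True
  | c, c => True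
  | _, _ => False

instance : PartialOrder Weakness where
  le := Weakness.le
  le_refl a := by cases a <;> exact trivial
  le_trans a b d h₁ h₂ := by
    cases a <;> cases b <;> cases d <;> first | exact trivial | exact h₁.elim | exact h₂.elim
  le_antisymm a b h₁ h₂ := by
    cases a <;> cases b <;> first | rfl | exact h₁.elim | exact h₂.elim

end Weakness

/-! ## Cells of a given weakness in a strict 2-category -/

section Cells

variable {B : Type u₁} [Bicategory.{w₁, v₁} B]

/-- The type of `w`-cells between parallel 1-cells. For a square whose upper-right composite is `f`
and whose lower-left composite is `g`, an `l`-cell is a 2-cell `f ⟶ g`, a `c`-cell is a 2-cell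
`g ⟶ f`, a `p`-cell is an invertible 2-cell, and an `s`-cell is an identity 2-cell. -/
def WCell (w : Weakness) {X Y : B} (f g : X ⟶ Y) : Type w₁ :=
  match w with
  | .s => ULift.{w₁} (PLift (f = g))
  | .p => f ≅ g
  | .l => f ⟶ g
  | .c => g ⟶ f

namespace WCell

/-- The identity 2-cell, seen as a `w`-cell. -/
def ofEq (w : Weakness) {X Y : B} {f g : X ⟶ Y} (h : f = g) : WCell w f g :=
  match w with
  | .s => ⟨⟨h⟩⟩
  | .p => eqToIso h
  | .l => eqToHom h
  | .c => eqToHom h.symm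

/-- Pasting (vertical composition) of `w`-cells. -/
def comp {w : Weakness} {X Y : B} {f g h : X ⟶ Y} (x : WCell w f g) (y : WCell w g h) :
    WCell w f h :=
  match w, x, y with
  | .s, x, y => ⟨⟨x.down.down.trans y.down.down⟩⟩
  | .p, x, y => Iso.trans x y
  | .l, x, y => CategoryStruct.comp (obj := X ⟶ Y) x y
  | .c, x, y => CategoryStruct.comp (obj := X ⟶ Y) y x

/-- Whiskering of a `w`-cell with a 1-cell on the left. -/
def whiskerLeft {w : Weakness} {X Y Z : B} (k : X ⟶ Y) {f g : Y ⟶ Z} (x : WCell w f g) :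
    WCell w (k ≫ f) (k ≫ g) :=
  match w, x with
  | .s, x => ⟨⟨congrArg (k ≫ ·) x.down.down⟩⟩
  | .p, x => whiskerLeftIso k x
  | .l, x => Bicategory.whiskerLeft k x
  | .c, x => Bicategory.whiskerLeft k x

/-- Whiskering of a `w`-cell with a 1-cell on the right. -/
def whiskerRight {w : Weakness} {X Y Z : B} {f g : X ⟶ Y} (x : WCell w f g) (k : Y ⟶ Z) :
    WCell w (f ≫ k) (g ≫ k) :=
  match w, x with
  | .s, x => ⟨⟨congrArg (· ≫ k) x.down.down⟩⟩
  | .p, x => whiskerRightIso x k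
  | .l, x => Bicategory.whiskerRight x k
  | .c, x => Bicategory.whiskerRight x k

/-- `Compat a b x y` says that the square of 2-cells with vertical sides the 2-cells `a : f ⟶ f'`
and `b : g ⟶ g'`, and horizontal sides the `w`-cells `x` (from `f` to `g`) and `y` (from `f'` to
`g'`), commutes. -/
def Compat {w : Weakness} {X Y : B} {f f' g g' : X ⟶ Y} (a : f ⟶ f') (b : g ⟶ g')
    (x : WCell w f g) (y : WCell w f' g') : Prop :=
  match w, x, y with
  | .s, x, y => a ≫ eqToHom y.down.down = eqToHom x.down.down ≫ b
  | .p, x, y => a ≫ Iso.hom y = Iso.hom x ≫ b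
  | .l, x, y => CategoryStruct.comp (obj := X ⟶ Y) a y = CategoryStruct.comp (obj := X ⟶ Y) x b
  | .c, x, y => CategoryStruct.comp (obj := X ⟶ Y) x a = CategoryStruct.comp (obj := X ⟶ Y) b y

/-- `x.IsOf w'` says that the `w`-cell `x` is a `w'`-cell, where `w' ≤ w`: it is an identity
if `w' = s`, and invertible if `w' = p`. (If `w'` is `l` or `c`, then `w' ≤ w` forces `w = w'`,
and there is no condition.) -/
def IsOf (w' : Weakness) {w : Weakness} {X Y : B} {f g : X ⟶ Y} (x : WCell w f g) : Prop :=
  match w' with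
  | .s => ∃ h : f = g, x = ofEq w h
  | .p => ∃ y : WCell w g f, x.comp y = ofEq w rfl ∧ y.comp x = ofEq w rfl
  | .l => True
  | .c => True

variable {w w' : Weakness} {X Y Z V : B}

@[simp]
theorem ofEq_comp_ofEq {f g h : X ⟶ Y} (p : f = g) (q : g = h) :
    (ofEq w p).comp (ofEq w q) = ofEq w (p.trans q) := by
  subst p; subst q
  cases w
  · rfl
  · exact Iso.ext (Category.comp_id (𝟙 f))
  · exact Category.comp_id (𝟙 f)
  · exact Category.comp_id (𝟙 f)

@[simp]
theorem ofEq_rfl_comp {f g : X ⟶ Y} (p : f = f) (x : WCell w f g) : (ofEq w p).comp x = x := by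
  cases w
  · rfl
  · exact Iso.ext (Category.id_comp (Iso.hom x))
  · exact Category.id_comp (obj := X ⟶ Y) x
  · exact Category.comp_id (obj := X ⟶ Y) x

@[simp]
theorem comp_ofEq_rfl {f g : X ⟶ Y} (p : g = g) (x : WCell w f g) : x.comp (ofEq w p) = x := by
  cases w
  · rfl
  · exact Iso.ext (Category.comp_id (Iso.hom x))
  · exact Category.comp_id (obj := X ⟶ Y) x
  · exact Category.id_comp (obj := X ⟶ Y) x

@[simp]
theorem comp_assoc {f g h k : X ⟶ Y} (x : WCell w f g) (y : WCell w g h) (z : WCell w h k) :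
    (x.comp y).comp z = x.comp (y.comp z) := by
  cases w
  · rfl
  · exact Iso.ext (Category.assoc (Iso.hom x) (Iso.hom y) (Iso.hom z))
  · exact Category.assoc (obj := X ⟶ Y) x y z
  · exact (Category.assoc (obj := X ⟶ Y) z y x).symm

@[simp]
theorem ofEq_comp_ofEq_comp {f g h k : X ⟶ Y} (p : f = g) (q : g = h) (x : WCell w h k) :
    (ofEq w p).comp ((ofEq w q).comp x) = (ofEq w (p.trans q)).comp x := by
  rw [← comp_assoc, ofEq_comp_ofEq]

@[simp]
theorem whiskerLeft_ofEq (k : X ⟶ Y) {f g : Y ⟶ Z} (h : f = g) :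
    (ofEq w h).whiskerLeft k = ofEq w (congrArg (k ≫ ·) h) := by
  subst h
  cases w
  · rfl
  · exact Iso.ext (whiskerLeft_id k f)
  · exact whiskerLeft_id k f
  · exact whiskerLeft_id k f

@[simp]
theorem whiskerRight_ofEq {f g : X ⟶ Y} (h : f = g) (k : Y ⟶ Z) :
    (ofEq w h).whiskerRight k = ofEq w (congrArg (· ≫ k) h) := by
  subst h
  cases w
  · rfl
  · exact Iso.ext (id_whiskerRight f k)
  · exact id_whiskerRight f k
  · exact id_whiskerRight f k

@[simp]
theorem whiskerLeft_comp (k : X ⟶ Y) {f g h : Y ⟶ Z} (x : WCell w f g) (y : WCell w g h) :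
    (x.comp y).whiskerLeft k = (x.whiskerLeft k).comp (y.whiskerLeft k) := by
  cases w
  · rfl
  · exact Iso.ext (Bicategory.whiskerLeft_comp k (Iso.hom x) (Iso.hom y))
  · exact Bicategory.whiskerLeft_comp k x y
  · exact Bicategory.whiskerLeft_comp k y x

@[simp]
theorem comp_whiskerRight {f g h : X ⟶ Y} (x : WCell w f g) (y : WCell w g h) (k : Y ⟶ Z) :
    (x.comp y).whiskerRight k = (x.whiskerRight k).comp (y.whiskerRight k) := by
  cases w
  · rfl
  · exact Iso.ext (Bicategory.comp_whiskerRight (Iso.hom x) (Iso.hom y) k)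
  · exact Bicategory.comp_whiskerRight x y k
  · exact Bicategory.comp_whiskerRight y x k

theorem IsOf.ofEq (w' : Weakness) {f g : X ⟶ Y} (h : f = g) : (ofEq w h).IsOf w' := by
  cases w'
  · exact ⟨h, rfl⟩
  · exact ⟨WCell.ofEq w h.symm, by simp, by simp⟩
  · trivial
  · trivial

theorem IsOf.comp {f g h : X ⟶ Y} {x : WCell w f g} {y : WCell w g h} (hx : x.IsOf w')
    (hy : y.IsOf w') : (x.comp y).IsOf w' := by
  cases w'
  · obtain ⟨p, rfl⟩ := hx
    obtain ⟨q, rfl⟩ := hy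
    exact ⟨p.trans q, by simp⟩
  · obtain ⟨x', h₁, h₂⟩ := hx
    obtain ⟨y', h₃, h₄⟩ := hy
    refine ⟨y'.comp x', ?_, ?_⟩
    · rw [comp_assoc, ← comp_assoc y, h₃, ofEq_rfl_comp, h₁]
    · rw [comp_assoc, ← comp_assoc x', h₂, ofEq_rfl_comp, h₄]
  · trivial
  · trivial

theorem IsOf.whiskerLeft (k : X ⟶ Y) {f g : Y ⟶ Z} {x : WCell w f g} (hx : x.IsOf w') :
    (x.whiskerLeft k).IsOf w' := by
  cases w'
  · obtain ⟨p, rfl⟩ := hx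
    exact ⟨congrArg (k ≫ ·) p, by simp⟩
  · obtain ⟨x', h₁, h₂⟩ := hx
    refine ⟨x'.whiskerLeft k, ?_, ?_⟩
    · rw [← whiskerLeft_comp, h₁, whiskerLeft_ofEq]
    · rw [← whiskerLeft_comp, h₂, whiskerLeft_ofEq]
  · trivial
  · trivial

theorem IsOf.whiskerRight {f g : X ⟶ Y} {x : WCell w f g} (hx : x.IsOf w') (k : Y ⟶ Z) :
    (x.whiskerRight k).IsOf w' := by
  cases w'
  · obtain ⟨p, rfl⟩ := hx
    exact ⟨congrArg (· ≫ k) p, by simp⟩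
  · obtain ⟨x', h₁, h₂⟩ := hx
    refine ⟨x'.whiskerRight k, ?_, ?_⟩
    · rw [← comp_whiskerRight, h₁, whiskerRight_ofEq]
    · rw [← comp_whiskerRight, h₂, whiskerRight_ofEq]
  · trivial
  · trivial

/-! Commuting squares paste. -/

theorem Compat.refl {f g : X ⟶ Y} (x : WCell w f g) : Compat (𝟙 f) (𝟙 g) x x := by
  cases w
  · exact (Category.id_comp _).trans (Category.comp_id _).symm
  · exact (Category.id_comp _).trans (Category.comp_id _).symm
  · exact (Category.id_comp (obj := X ⟶ Y) x).trans (Category.comp_id (obj := X ⟶ Y) x).symm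
  · exact (Category.comp_id (obj := X ⟶ Y) x).trans (Category.id_comp (obj := X ⟶ Y) x).symm

theorem Compat.vcomp {f f' f'' g g' g'' : X ⟶ Y} {a : f ⟶ f'} {a' : f' ⟶ f''} {b : g ⟶ g'}
    {b' : g' ⟶ g''} {x : WCell w f g} {y : WCell w f' g'} {z : WCell w f'' g''}
    (h : Compat a b x y) (h' : Compat a' b' y z) : Compat (a ≫ a') (b ≫ b') x z := by
  cases w
  · change a ≫ _ = _ ≫ b at h
    change a' ≫ _ = _ ≫ b' at h'
    change (a ≫ a') ≫ _ = _ ≫ b ≫ b'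
    rw [Category.assoc, h', reassoc_of% h]
  · change a ≫ _ = _ ≫ b at h
    change a' ≫ _ = _ ≫ b' at h'
    change (a ≫ a') ≫ _ = _ ≫ b ≫ b'
    rw [Category.assoc, h', reassoc_of% h]
  · change f ⟶ g at x
    change f' ⟶ g' at y
    change f'' ⟶ g'' at z
    change a ≫ y = x ≫ b at h
    change a' ≫ z = y ≫ b' at h'
    change (a ≫ a') ≫ z = x ≫ b ≫ b'
    rw [Category.assoc, h', reassoc_of% h]
  · change g ⟶ f at x
    change g' ⟶ f' at y
    change g'' ⟶ f'' at z
    change x ≫ a = b ≫ y at h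
    change y ≫ a' = b' ≫ z at h'
    change x ≫ a ≫ a' = (b ≫ b') ≫ z
    rw [Category.assoc, ← h', reassoc_of% h]

theorem Compat.hcomp {f f' g g' h h' : X ⟶ Y} {a : f ⟶ f'} {b : g ⟶ g'} {c : h ⟶ h'}
    {x : WCell w f g} {x' : WCell w f' g'} {y : WCell w g h} {y' : WCell w g' h'}
    (p : Compat a b x x') (q : Compat b c y y') : Compat a c (x.comp y) (x'.comp y') := by
  cases w
  · change a ≫ _ = _ ≫ b at p
    change b ≫ _ = _ ≫ c at q
    change a ≫ eqToHom _ = eqToHom _ ≫ c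
    rw [← eqToHom_trans x'.down.down y'.down.down, ← eqToHom_trans x.down.down y.down.down,
      reassoc_of% p, q, Category.assoc]
  · change a ≫ _ = _ ≫ b at p
    change b ≫ _ = _ ≫ c at q
    change a ≫ (Iso.hom x' ≫ Iso.hom y') = (Iso.hom x ≫ Iso.hom y) ≫ c
    rw [reassoc_of% p, q, Category.assoc]
  · change f ⟶ g at x
    change f' ⟶ g' at x'
    change g ⟶ h at y
    change g' ⟶ h' at y'
    change a ≫ x' = x ≫ b at p
    change b ≫ y' = y ≫ c at q
    change a ≫ x' ≫ y' = (x ≫ y) ≫ c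
    rw [reassoc_of% p, q, Category.assoc]
  · change g ⟶ f at x
    change g' ⟶ f' at x'
    change h ⟶ g at y
    change h' ⟶ g' at y'
    change x ≫ a = b ≫ x' at p
    change y ≫ b = c ≫ y' at q
    change (y ≫ x) ≫ a = c ≫ y' ≫ x'
    rw [Category.assoc, p, reassoc_of% q]

theorem Compat.ofEq {f f' g g' : X ⟶ Y} {a : f ⟶ f'} {b : g ⟶ g'} (h : f = g) (h' : f' = g')
    (e : a ≫ eqToHom h' = eqToHom h ≫ b) : Compat a b (ofEq w h) (ofEq w h') := by
  subst h; subst h'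
  have e' : a = b := by simpa using e
  subst e'
  cases w
  · exact (Category.comp_id a).trans (Category.id_comp a).symm
  · exact (Category.comp_id a).trans (Category.id_comp a).symm
  · exact (Category.comp_id a).trans (Category.id_comp a).symm
  · exact (Category.id_comp a).trans (Category.comp_id a).symm

theorem Compat.whiskerLeft (k : X ⟶ Y) {f f' g g' : Y ⟶ Z} {a : f ⟶ f'} {b : g ⟶ g'}
    {x : WCell w f g} {y : WCell w f' g'} (h : Compat a b x y) :
    Compat (k ◁ a) (k ◁ b) (x.whiskerLeft k) (y.whiskerLeft k) := by
  cases w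
  · change a ≫ _ = _ ≫ b at h
    change k ◁ a ≫ eqToHom _ = eqToHom _ ≫ k ◁ b
    have := congrArg (k ◁ ·) h
    simpa using this
  · change a ≫ _ = _ ≫ b at h
    change k ◁ a ≫ k ◁ Iso.hom y = k ◁ Iso.hom x ≫ k ◁ b
    rw [← Bicategory.whiskerLeft_comp, h, Bicategory.whiskerLeft_comp]
  · change f ⟶ g at x
    change f' ⟶ g' at y
    change a ≫ y = x ≫ b at h
    change k ◁ a ≫ k ◁ y = k ◁ x ≫ k ◁ b
    rw [← Bicategory.whiskerLeft_comp, h, Bicategory.whiskerLeft_comp]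
  · change g ⟶ f at x
    change g' ⟶ f' at y
    change x ≫ a = b ≫ y at h
    change k ◁ x ≫ k ◁ a = k ◁ b ≫ k ◁ y
    rw [← Bicategory.whiskerLeft_comp, h, Bicategory.whiskerLeft_comp]

theorem Compat.whiskerRight {f f' g g' : X ⟶ Y} {a : f ⟶ f'} {b : g ⟶ g'}
    {x : WCell w f g} {y : WCell w f' g'} (h : Compat a b x y) (k : Y ⟶ Z) :
    Compat (a ▷ k) (b ▷ k) (x.whiskerRight k) (y.whiskerRight k) := by
  cases w
  · change a ≫ _ = _ ≫ b at h
    change a ▷ k ≫ eqToHom _ = eqToHom _ ≫ b ▷ k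
    have := congrArg (· ▷ k) h
    simpa using this
  · change a ≫ _ = _ ≫ b at h
    change a ▷ k ≫ Iso.hom y ▷ k = Iso.hom x ▷ k ≫ b ▷ k
    rw [← Bicategory.comp_whiskerRight, h, Bicategory.comp_whiskerRight]
  · change f ⟶ g at x
    change f' ⟶ g' at y
    change a ≫ y = x ≫ b at h
    change a ▷ k ≫ y ▷ k = x ▷ k ≫ b ▷ k
    rw [← Bicategory.comp_whiskerRight, h, Bicategory.comp_whiskerRight]
  · change g ⟶ f at x
    change g' ⟶ f' at y
    change x ≫ a = b ≫ y at h
    change x ▷ k ≫ a ▷ k = b ▷ k ≫ y ▷ k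
    rw [← Bicategory.comp_whiskerRight, h, Bicategory.comp_whiskerRight]

theorem Compat.exchangeLeft {k k' : X ⟶ Y} (a : k ⟶ k') {f g : Y ⟶ Z} (x : WCell w f g) :
    Compat (a ▷ f) (a ▷ g) (x.whiskerLeft k) (x.whiskerLeft k') := by
  cases w
  · obtain ⟨⟨rfl⟩⟩ := x
    exact (Category.comp_id _).trans (Category.id_comp _).symm
  · exact (whisker_exchange a (Iso.hom x)).symm
  · exact (whisker_exchange a x).symm
  · exact whisker_exchange a x

theorem Compat.exchangeRight {f g : X ⟶ Y} (x : WCell w f g) {k k' : Y ⟶ Z} (a : k ⟶ k') :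
    Compat (f ◁ a) (g ◁ a) (x.whiskerRight k) (x.whiskerRight k') := by
  cases w
  · obtain ⟨⟨rfl⟩⟩ := x
    exact (Category.comp_id _).trans (Category.id_comp _).symm
  · exact whisker_exchange (Iso.hom x) a
  · exact whisker_exchange x a
  · exact (whisker_exchange x a).symm

theorem compat_eqToHom {f f' g g' : X ⟶ Y} (h : f = f') (h' : g = g') (x : WCell w f g)
    (y : WCell w f' g') :
    Compat (eqToHom h) (eqToHom h') x y ↔ x = (ofEq w h).comp (y.comp (ofEq w h'.symm)) := by
  subst h; subst h'
  simp only [eqToHom_refl, ofEq_rfl_comp, comp_ofEq_rfl]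
  cases w
  · exact ⟨fun _ => Subsingleton.elim (α := ULift (PLift (f = g))) _ _,
      fun _ => (Category.id_comp _).trans (Category.comp_id _).symm⟩
  · change 𝟙 f ≫ Iso.hom y = Iso.hom x ≫ 𝟙 g ↔ _
    rw [Category.id_comp, Category.comp_id]
    exact ⟨fun e => (Iso.ext e).symm, fun e => congrArg Iso.hom e.symm⟩
  · change f ⟶ g at x y
    change 𝟙 f ≫ y = x ≫ 𝟙 g ↔ _
    rw [Category.id_comp, Category.comp_id]
    exact eq_comm
  · change g ⟶ f at x y
    change x ≫ 𝟙 f = 𝟙 g ≫ y ↔ _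
    rw [Category.id_comp, Category.comp_id]
    exact Iff.rfl

theorem exchange {f g : X ⟶ Y} (x : WCell w f g) {h k : Y ⟶ Z} (y : WCell w h k) :
    (x.whiskerRight h).comp (y.whiskerLeft g) = (y.whiskerLeft f).comp (x.whiskerRight k) := by
  cases w
  · rfl
  · exact Iso.ext (whisker_exchange (Iso.hom x) (Iso.hom y)).symm
  · exact (whisker_exchange x y).symm
  · exact whisker_exchange x y

theorem exchange_comp {f g : X ⟶ Y} (x : WCell w f g) {h k : Y ⟶ Z} (y : WCell w h k)
    {m : X ⟶ Z} (z : WCell w (g ≫ k) m) :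
    (x.whiskerRight h).comp ((y.whiskerLeft g).comp z) =
      (y.whiskerLeft f).comp ((x.whiskerRight k).comp z) := by
  rw [← comp_assoc, exchange, comp_assoc]

section Strict

variable [Bicategory.Strict B]

theorem id_whiskerLeft {f g : X ⟶ Y} (x : WCell w f g) :
    x.whiskerLeft (𝟙 X) =
      (ofEq w (Strict.id_comp f)).comp (x.comp (ofEq w (Strict.id_comp g).symm)) := by
  rw [← compat_eqToHom (Strict.id_comp f) (Strict.id_comp g)]
  have e (k : X ⟶ Y) : eqToHom (Strict.id_comp k) = (λ_ k).hom := by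
    rw [Strict.leftUnitor_eqToIso]; rfl
  rw [e, e]
  cases w
  · obtain ⟨⟨rfl⟩⟩ := x
    exact (Category.comp_id _).trans (Category.id_comp _).symm
  · exact (leftUnitor_naturality (Iso.hom x)).symm
  · exact (leftUnitor_naturality x).symm
  · exact leftUnitor_naturality x

theorem whiskerRight_id {f g : X ⟶ Y} (x : WCell w f g) :
    x.whiskerRight (𝟙 Y) =
      (ofEq w (Strict.comp_id f)).comp (x.comp (ofEq w (Strict.comp_id g).symm)) := by
  rw [← compat_eqToHom (Strict.comp_id f) (Strict.comp_id g)]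
  have e (k : X ⟶ Y) : eqToHom (Strict.comp_id k) = (ρ_ k).hom := by
    rw [Strict.rightUnitor_eqToIso]; rfl
  rw [e, e]
  cases w
  · obtain ⟨⟨rfl⟩⟩ := x
    exact (Category.comp_id _).trans (Category.id_comp _).symm
  · exact (rightUnitor_naturality (Iso.hom x)).symm
  · exact (rightUnitor_naturality x).symm
  · exact rightUnitor_naturality x

theorem eqToHom_assoc (f : X ⟶ Y) (g : Y ⟶ Z) (h : Z ⟶ V) :
    eqToHom (Strict.assoc f g h) = (α_ f g h).hom := by
  rw [Strict.associator_eqToIso]; rfl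

theorem whiskerLeft_whiskerLeft (k : X ⟶ Y) (m : Y ⟶ Z) {f g : Z ⟶ V} (x : WCell w f g) :
    (x.whiskerLeft m).whiskerLeft k =
      (ofEq w (Strict.assoc k m f).symm).comp
        ((x.whiskerLeft (k ≫ m)).comp (ofEq w (Strict.assoc k m g))) := by
  have h : x.whiskerLeft (k ≫ m) = (ofEq w (Strict.assoc k m f)).comp
      (((x.whiskerLeft m).whiskerLeft k).comp (ofEq w (Strict.assoc k m g).symm)) := by
    rw [← compat_eqToHom (Strict.assoc k m f) (Strict.assoc k m g), eqToHom_assoc, eqToHom_assoc]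
    cases w
    · obtain ⟨⟨rfl⟩⟩ := x
      exact (Category.comp_id _).trans (Category.id_comp _).symm
    · exact (associator_naturality_right k m (Iso.hom x)).symm
    · exact (associator_naturality_right k m x).symm
    · exact associator_naturality_right k m x
  rw [h]; simp

theorem whiskerRight_whiskerRight {f g : X ⟶ Y} (x : WCell w f g) (k : Y ⟶ Z) (m : Z ⟶ V) :
    (x.whiskerRight k).whiskerRight m =
      (ofEq w (Strict.assoc f k m)).comp
        ((x.whiskerRight (k ≫ m)).comp (ofEq w (Strict.assoc g k m).symm)) := by
  rw [← compat_eqToHom (Strict.assoc f k m) (Strict.assoc g k m), eqToHom_assoc, eqToHom_assoc]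
  cases w
  · obtain ⟨⟨rfl⟩⟩ := x
    exact (Category.comp_id _).trans (Category.id_comp _).symm
  · exact (associator_naturality_left (Iso.hom x) k m).symm
  · exact (associator_naturality_left x k m).symm
  · exact associator_naturality_left x k m

theorem whiskerLeft_whiskerRight (k : X ⟶ Y) {f g : Y ⟶ Z} (x : WCell w f g) (m : Z ⟶ V) :
    (x.whiskerLeft k).whiskerRight m =
      (ofEq w (Strict.assoc k f m)).comp
        (((x.whiskerRight m).whiskerLeft k).comp (ofEq w (Strict.assoc k g m).symm)) := by
  rw [← compat_eqToHom (Strict.assoc k f m) (Strict.assoc k g m), eqToHom_assoc, eqToHom_assoc]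
  cases w
  · obtain ⟨⟨rfl⟩⟩ := x
    exact (Category.comp_id _).trans (Category.id_comp _).symm
  · exact (associator_naturality_middle k (Iso.hom x) m).symm
  · exact (associator_naturality_middle k x m).symm
  · exact associator_naturality_middle k x m

end Strict

end WCell

end Cells

/-! ## Enhanced 2-categories -/

set_option linter.checkUnivs false in
/-- An enhanced 2-category (`ℱ`-category): a strict 2-category, whose 1-cells are called loose
morphisms, with a wide and locally full sub-2-category, whose 1-cells are called tight. -/
class FCategory (B : Type u₁) extends Bicategory.{w₁, v₁} B, Bicategory.Strict B where
  Tight : ∀ {X Y : B}, (X ⟶ Y) → Prop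
  tight_id : ∀ X : B, Tight (𝟙 X)
  tight_comp : ∀ {X Y Z : B} (f : X ⟶ Y) (g : Y ⟶ Z), Tight f → Tight g → Tight (f ≫ g)

/-- An enhanced 2-functor (`ℱ`-functor): a (strict) 2-functor preserving tightness. -/
structure FFunctor (B : Type u₁) [FCategory.{w₁, v₁} B] (C : Type u₂) [FCategory.{w₂, v₂} C]
    extends StrictPseudofunctorPreCore B C where
  map_tight : ∀ {X Y : B} (f : X ⟶ Y), FCategory.Tight f → FCategory.Tight (map f)

namespace FFunctor

variable {B : Type u₁} [FCategory.{w₁, v₁} B] {C : Type u₂} [FCategory.{w₂, v₂} C]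
  {D : Type u₃} [FCategory.{w₃, v₃} D]

/-- The identity `ℱ`-functor. -/
def id (B : Type u₁) [FCategory.{w₁, v₁} B] : FFunctor B B where
  obj X := X
  map f := f
  map₂ η := η
  map₂_id _ := rfl
  map₂_comp _ _ := rfl
  map_id _ := rfl
  map_comp _ _ := rfl
  map₂_whisker_left _ _ _ _ := by simp
  map₂_whisker_right _ _ := by simp
  map_tight _ h := h

/-- Composition of `ℱ`-functors. -/
def comp (F : FFunctor B C) (G : FFunctor C D) : FFunctor B D where
  obj X := G.obj (F.obj X)
  map f := G.map (F.map f)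
  map₂ η := G.map₂ (F.map₂ η)
  map₂_id _ := by simp
  map₂_comp _ _ := by simp
  map_id X := (congrArg G.map (F.map_id X)).trans (G.map_id _)
  map_comp f g := (congrArg G.map (F.map_comp f g)).trans (G.map_comp _ _)
  map₂_whisker_left f _ _ η := by
    simp [F.map₂_whisker_left, G.map₂_whisker_left, PrelaxFunctor.map₂_eqToHom]
  map₂_whisker_right η g := by
    simp [F.map₂_whisker_right, G.map₂_whisker_right, PrelaxFunctor.map₂_eqToHom]
  map_tight f h := G.map_tight _ (F.map_tight f h)

theorem map_whiskerRight (G : FFunctor B C) {X Y Z : B} {f f' : X ⟶ Y} (η : f ⟶ f') (g : Y ⟶ Z) :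
    G.map₂ η ▷ G.map g = eqToHom (G.map_comp f g).symm ≫ G.map₂ (η ▷ g) ≫
      eqToHom (G.map_comp f' g) := by
  simp [G.map₂_whisker_right]

theorem map_whiskerLeft_sq (G : FFunctor B C) {X Y Z : B} (f : X ⟶ Y) {g g' : Y ⟶ Z} (η : g ⟶ g') :
    G.map f ◁ G.map₂ η ≫ eqToHom (G.map_comp f g').symm =
      eqToHom (G.map_comp f g).symm ≫ G.map₂ (f ◁ η) := by
  simp [G.map₂_whisker_left]

end FFunctor

/-- Mutually inverse `ℱ`-functors, i.e. an isomorphism of `ℱ`-categories. -/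
structure FIso (B : Type u₁) [FCategory.{w₁, v₁} B] (C : Type u₂) [FCategory.{w₂, v₂} C] where
  hom : FFunctor B C
  inv : FFunctor C B
  hom_inv_id : hom.comp inv = FFunctor.id B
  inv_hom_id : inv.comp hom = FFunctor.id C

/-! ## Loose natural transformations and modifications -/

section Functors

variable {S : Type u₁} [FCategory.{w₁, v₁} S] {C : Type u₂} [FCategory.{w₂, v₂} C]

/-- A loose `(w', w)`-natural transformation: a `w`-natural transformation of the underlying
2-functors, with loose components, whose restriction to the tight morphisms is `w'`-natural. -/
structure LooseTrans (w' w : Weakness) (F G : FFunctor S C) where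
  app (X : S) : F.obj X ⟶ G.obj X
  cell {X Y : S} (f : X ⟶ Y) : WCell w (app X ≫ G.map f) (F.map f ≫ app Y)
  cell_isOf {X Y : S} (f : X ⟶ Y) : FCategory.Tight f → (cell f).IsOf w'
  naturality {X Y : S} {f g : X ⟶ Y} (σ : f ⟶ g) :
    WCell.Compat (app X ◁ G.map₂ σ) (F.map₂ σ ▷ app Y) (cell f) (cell g)
  cell_id (X : S) : cell (𝟙 X) = WCell.ofEq w (by
    rw [F.map_id, G.map_id, Strict.comp_id, Strict.id_comp])
  cell_comp {X Y Z : S} (f : X ⟶ Y) (g : Y ⟶ Z) :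
    cell (f ≫ g) =
      (WCell.ofEq w (by rw [G.map_comp, Strict.assoc])).comp
        (((cell f).whiskerRight (G.map g)).comp
          ((WCell.ofEq w (Strict.assoc _ _ _)).comp
            (((cell g).whiskerLeft (F.map f)).comp
              (WCell.ofEq w (by rw [F.map_comp, Strict.assoc])))))

namespace LooseTrans

variable {w' w : Weakness} {F G H K : FFunctor S C}

theorem ext' {φ ψ : LooseTrans w' w F G} (h : ∀ X, φ.app X = ψ.app X)
    (h' : ∀ {X Y : S} (f : X ⟶ Y), φ.cell f =
      (WCell.ofEq w (by rw [h])).comp ((ψ.cell f).comp (WCell.ofEq w (by rw [h])))) :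
    φ = ψ := by
  obtain ⟨a, c, _, _, _, _⟩ := φ
  obtain ⟨a', c', _, _, _, _⟩ := ψ
  obtain rfl : a = a' := funext h
  have : @c = @c' := by
    funext X Y f
    simpa using h' f
  subst this
  rfl

/-- The identity transformation. -/
def id (w' w : Weakness) (F : FFunctor S C) : LooseTrans w' w F F where
  app X := 𝟙 (F.obj X)
  cell f := WCell.ofEq w (by rw [Strict.comp_id, Strict.id_comp])
  cell_isOf _ _ := WCell.IsOf.ofEq _ _
  naturality σ := WCell.Compat.ofEq _ _ (by
    simp [Strict.leftUnitor_eqToIso, Strict.rightUnitor_eqToIso])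
  cell_id _ := rfl
  cell_comp f g := by simp

/-- Composition of transformations. -/
def comp (φ : LooseTrans w' w F G) (ψ : LooseTrans w' w G H) : LooseTrans w' w F H where
  app X := φ.app X ≫ ψ.app X
  cell {X Y} f :=
    (WCell.ofEq w (Strict.assoc _ _ _)).comp
      (((ψ.cell f).whiskerLeft (φ.app X)).comp
        ((WCell.ofEq w (Strict.assoc _ _ _).symm).comp
          (((φ.cell f).whiskerRight (ψ.app Y)).comp
            (WCell.ofEq w (Strict.assoc _ _ _)))))
  cell_isOf {X Y} f h :=
    (WCell.IsOf.ofEq _ _).comp <| ((ψ.cell_isOf f h).whiskerLeft _).comp <|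
      (WCell.IsOf.ofEq _ _).comp <| ((φ.cell_isOf f h).whiskerRight _).comp (WCell.IsOf.ofEq _ _)
  naturality {X Y f g} σ := by
    refine WCell.Compat.hcomp (b := φ.app X ◁ ψ.app X ◁ H.map₂ σ) (WCell.Compat.ofEq _ _ ?_) <|
      ((ψ.naturality σ).whiskerLeft (φ.app X)).hcomp <|
      WCell.Compat.hcomp (b := (φ.app X ◁ G.map₂ σ) ▷ ψ.app Y) (WCell.Compat.ofEq _ _ ?_) <|
      ((φ.naturality σ).whiskerRight (ψ.app Y)).hcomp (WCell.Compat.ofEq _ _ ?_)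
    · simp [Strict.associator_eqToIso]
    · simp [Strict.associator_eqToIso]
    · simp [Strict.associator_eqToIso]
  cell_id X := by
    simp [φ.cell_id, ψ.cell_id]
  cell_comp {X Y Z} f g := by
    simp [φ.cell_comp, ψ.cell_comp, WCell.whiskerLeft_whiskerLeft,
      WCell.whiskerRight_whiskerRight, WCell.whiskerLeft_whiskerRight, WCell.exchange_comp]

theorem id_comp (φ : LooseTrans w' w F G) : (id w' w F).comp φ = φ :=
  ext' (fun _ => Strict.id_comp _) fun f => by
    simp [comp, id, WCell.id_whiskerLeft]

theorem comp_id (φ : LooseTrans w' w F G) : φ.comp (id w' w G) = φ :=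
  ext' (fun _ => Strict.comp_id _) fun f => by
    simp [comp, id, WCell.whiskerRight_id]

theorem assoc (φ : LooseTrans w' w F G) (ψ : LooseTrans w' w G H) (χ : LooseTrans w' w H K) :
    (φ.comp ψ).comp χ = φ.comp (ψ.comp χ) :=
  ext' (fun _ => Strict.assoc _ _ _) fun f => by
    dsimp only [comp]
    simp [WCell.whiskerLeft_whiskerLeft,
      WCell.whiskerRight_whiskerRight, WCell.whiskerLeft_whiskerRight]
    erw [WCell.ofEq_comp_ofEq_comp, WCell.ofEq_comp_ofEq]

end LooseTrans

/-- A transformation is tight if its components are tight and all of its cells are `w'`-cells. -/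
def LooseTrans.IsTight {w' w : Weakness} {F G : FFunctor S C} (φ : LooseTrans w' w F G) : Prop :=
  (∀ X, FCategory.Tight (φ.app X)) ∧ ∀ {X Y : S} (f : X ⟶ Y), (φ.cell f).IsOf w'

theorem LooseTrans.IsTight.comp {w' w : Weakness} {F G H : FFunctor S C} {φ : LooseTrans w' w F G}
    {ψ : LooseTrans w' w G H} (h₁ : φ.IsTight) (h₂ : ψ.IsTight) : (φ.comp ψ).IsTight :=
  ⟨fun X => FCategory.tight_comp _ _ (h₁.1 X) (h₂.1 X), fun f =>
    (WCell.IsOf.ofEq _ _).comp <| ((h₂.2 f).whiskerLeft _).comp <|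
      (WCell.IsOf.ofEq _ _).comp <| ((h₁.2 f).whiskerRight _).comp (WCell.IsOf.ofEq _ _)⟩

/-- Modifications between loose `(w', w)`-natural transformations. -/
@[ext]
structure Modification {w' w : Weakness} {F G : FFunctor S C} (φ ψ : LooseTrans w' w F G) where
  app (X : S) : φ.app X ⟶ ψ.app X
  naturality {X Y : S} (f : X ⟶ Y) :
    WCell.Compat (app X ▷ G.map f) (F.map f ◁ app Y) (φ.cell f) (ψ.cell f)

namespace Modification

variable {w' w : Weakness} {F G H : FFunctor S C}

/-- The identity modification. -/
def id (φ : LooseTrans w' w F G) : Modification φ φ where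
  app X := 𝟙 (φ.app X)
  naturality f := by
    rw [id_whiskerRight, Bicategory.whiskerLeft_id]
    exact WCell.Compat.refl _

/-- Composition of modifications. -/
def comp {φ ψ χ : LooseTrans w' w F G} (Γ : Modification φ ψ) (Ξ : Modification ψ χ) :
    Modification φ χ where
  app X := Γ.app X ≫ Ξ.app X
  naturality f := by
    rw [comp_whiskerRight, Bicategory.whiskerLeft_comp]
    exact (Γ.naturality f).vcomp (Ξ.naturality f)

/-- Left whiskering of a modification with a transformation. -/
def whiskerLeft (φ : LooseTrans w' w F G) {ψ χ : LooseTrans w' w G H} (Γ : Modification ψ χ) :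
    Modification (φ.comp ψ) (φ.comp χ) where
  app X := φ.app X ◁ Γ.app X
  naturality {X Y} f := by
    refine WCell.Compat.hcomp (b := φ.app X ◁ (Γ.app X ▷ H.map f)) (WCell.Compat.ofEq _ _ ?_) <|
      ((Γ.naturality f).whiskerLeft _).hcomp <|
      WCell.Compat.hcomp (b := (φ.app X ≫ G.map f) ◁ Γ.app Y) (WCell.Compat.ofEq _ _ ?_) <|
      (WCell.Compat.exchangeRight (φ.cell f) (Γ.app Y)).hcomp (WCell.Compat.ofEq _ _ ?_) <;>
    simp [LooseTrans.comp, Strict.associator_eqToIso]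

/-- Right whiskering of a modification with a transformation. -/
def whiskerRight {φ ψ : LooseTrans w' w F G} (Γ : Modification φ ψ) (χ : LooseTrans w' w G H) :
    Modification (φ.comp χ) (ψ.comp χ) where
  app X := Γ.app X ▷ χ.app X
  naturality {X Y} f := by
    refine WCell.Compat.hcomp (b := Γ.app X ▷ (χ.app X ≫ H.map f)) (WCell.Compat.ofEq _ _ ?_) <|
      (WCell.Compat.exchangeLeft (Γ.app X) (χ.cell f)).hcomp <|
      WCell.Compat.hcomp (b := (Γ.app X ▷ G.map f) ▷ χ.app Y) (WCell.Compat.ofEq _ _ ?_) <|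
      ((Γ.naturality f).whiskerRight _).hcomp (WCell.Compat.ofEq _ _ ?_) <;>
    simp [LooseTrans.comp, Strict.associator_eqToIso]

end Modification

/-- The underlying type of the `ℱ`-category `Fun_{w', w}(S, C)`; its objects are `ℱ`-functors. -/
def FunCat (_w' _w : Weakness) (S : Type u₁) [FCategory.{w₁, v₁} S] (C : Type u₂)
    [FCategory.{w₂, v₂} C] :=
  FFunctor S C

namespace FunCat

variable {w' w : Weakness}

/-- An `ℱ`-functor, as an object of `Fun_{w', w}(S, C)`. -/
def of (w' w : Weakness) (F : FFunctor S C) : FunCat w' w S C := F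

/-- The `ℱ`-functor underlying an object of `Fun_{w', w}(S, C)`. -/
def toFFunctor (F : FunCat w' w S C) : FFunctor S C := F

instance : CategoryStruct (FunCat w' w S C) where
  Hom F G := LooseTrans w' w F G
  id F := LooseTrans.id w' w F
  comp φ ψ := LooseTrans.comp φ ψ

instance (F G : FunCat w' w S C) : Category (F ⟶ G) where
  Hom φ ψ := Modification φ ψ
  id φ := Modification.id φ
  comp Γ Ξ := Modification.comp Γ Ξ
  id_comp _ := Modification.ext (funext fun _ => Category.id_comp _)
  comp_id _ := Modification.ext (funext fun _ => Category.comp_id _)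
  assoc _ _ _ := Modification.ext (funext fun _ => Category.assoc _ _ _)

theorem hom_ext {F G : FunCat w' w S C} {φ ψ : F ⟶ G} {Γ Ξ : φ ⟶ ψ}
    (h : ∀ X, Modification.app Γ X = Modification.app Ξ X) : Γ = Ξ :=
  Modification.ext (funext h)

@[simp]
theorem id_app {F G : FunCat w' w S C} (φ : F ⟶ G) (X : S) :
    Modification.app (𝟙 φ) X = 𝟙 (LooseTrans.app φ X) := rfl

@[simp]
theorem comp_app {F G : FunCat w' w S C} {φ ψ χ : F ⟶ G} (Γ : φ ⟶ ψ) (Ξ : ψ ⟶ χ) (X : S) :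
    Modification.app (Γ ≫ Ξ) X = Modification.app Γ X ≫ Modification.app Ξ X := rfl

theorem eqToHom_app {F G : FunCat w' w S C} {φ ψ : F ⟶ G} (h : φ = ψ) (X : S) :
    Modification.app (eqToHom h) X =
      eqToHom (congrArg (fun χ : LooseTrans w' w F G => χ.app X) h) := by
  subst h; rfl

theorem assoc_hom_app {F G H K : FunCat w' w S C} (φ : F ⟶ G) (ψ : G ⟶ H) (χ : H ⟶ K) (X : S) :
    Modification.app (eqToIso (LooseTrans.assoc φ ψ χ) : (φ ≫ ψ) ≫ χ ≅ φ ≫ ψ ≫ χ).hom X =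
      (α_ (LooseTrans.app φ X) (LooseTrans.app ψ X) (LooseTrans.app χ X)).hom := by
  rw [Strict.associator_eqToIso]
  exact eqToHom_app (LooseTrans.assoc φ ψ χ) X

theorem assoc_inv_app {F G H K : FunCat w' w S C} (φ : F ⟶ G) (ψ : G ⟶ H) (χ : H ⟶ K) (X : S) :
    Modification.app (eqToIso (LooseTrans.assoc φ ψ χ) : (φ ≫ ψ) ≫ χ ≅ φ ≫ ψ ≫ χ).inv X =
      (α_ (LooseTrans.app φ X) (LooseTrans.app ψ X) (LooseTrans.app χ X)).inv := by
  rw [Strict.associator_eqToIso]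
  exact eqToHom_app (LooseTrans.assoc φ ψ χ).symm X

theorem id_comp_hom_app {F G : FunCat w' w S C} (φ : F ⟶ G) (X : S) :
    Modification.app (eqToIso (LooseTrans.id_comp φ) : 𝟙 F ≫ φ ≅ φ).hom X =
      (λ_ (LooseTrans.app φ X)).hom := by
  rw [Strict.leftUnitor_eqToIso]
  exact eqToHom_app (LooseTrans.id_comp φ) X

theorem id_comp_inv_app {F G : FunCat w' w S C} (φ : F ⟶ G) (X : S) :
    Modification.app (eqToIso (LooseTrans.id_comp φ) : 𝟙 F ≫ φ ≅ φ).inv X =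
      (λ_ (LooseTrans.app φ X)).inv := by
  rw [Strict.leftUnitor_eqToIso]
  exact eqToHom_app (LooseTrans.id_comp φ).symm X

theorem comp_id_hom_app {F G : FunCat w' w S C} (φ : F ⟶ G) (X : S) :
    Modification.app (eqToIso (LooseTrans.comp_id φ) : φ ≫ 𝟙 G ≅ φ).hom X =
      (ρ_ (LooseTrans.app φ X)).hom := by
  rw [Strict.rightUnitor_eqToIso]
  exact eqToHom_app (LooseTrans.comp_id φ) X

theorem comp_id_inv_app {F G : FunCat w' w S C} (φ : F ⟶ G) (X : S) :
    Modification.app (eqToIso (LooseTrans.comp_id φ) : φ ≫ 𝟙 G ≅ φ).inv X =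
      (ρ_ (LooseTrans.app φ X)).inv := by
  rw [Strict.rightUnitor_eqToIso]
  exact eqToHom_app (LooseTrans.comp_id φ).symm X

instance : Bicategory (FunCat w' w S C) where
  whiskerLeft φ _ _ Γ := Modification.whiskerLeft φ Γ
  whiskerRight Γ χ := Modification.whiskerRight Γ χ
  associator φ ψ χ := eqToIso (LooseTrans.assoc φ ψ χ)
  leftUnitor φ := eqToIso (LooseTrans.id_comp φ)
  rightUnitor φ := eqToIso (LooseTrans.comp_id φ)
  whiskerLeft_id φ ψ := hom_ext fun X => Bicategory.whiskerLeft_id _ _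
  whiskerLeft_comp φ _ _ _ Γ Ξ := hom_ext fun X => Bicategory.whiskerLeft_comp _ _ _
  id_whiskerLeft Γ := by
    refine hom_ext fun X => ?_
    rw [comp_app, comp_app, id_comp_hom_app, id_comp_inv_app]
    exact Bicategory.id_whiskerLeft (Modification.app Γ X)
  comp_whiskerLeft φ ψ _ _ Γ := by
    refine hom_ext fun X => ?_
    rw [comp_app, comp_app, assoc_hom_app, assoc_inv_app]
    exact Bicategory.comp_whiskerLeft (LooseTrans.app φ X) (LooseTrans.app ψ X) (Modification.app Γ X)
  id_whiskerRight _ _ := hom_ext fun X => Bicategory.id_whiskerRight _ _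
  comp_whiskerRight _ _ _ := hom_ext fun X => Bicategory.comp_whiskerRight _ _ _
  whiskerRight_id Γ := by
    refine hom_ext fun X => ?_
    rw [comp_app, comp_app, comp_id_hom_app, comp_id_inv_app]
    exact Bicategory.whiskerRight_id (Modification.app Γ X)
  whiskerRight_comp Γ φ ψ := by
    refine hom_ext fun X => ?_
    rw [comp_app, comp_app, assoc_hom_app, assoc_inv_app]
    exact Bicategory.whiskerRight_comp (Modification.app Γ X) (LooseTrans.app φ X) (LooseTrans.app ψ X)
  whisker_assoc φ _ _ Γ ψ := by
    refine hom_ext fun X => ?_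
    rw [comp_app, comp_app, assoc_hom_app, assoc_inv_app]
    exact Bicategory.whisker_assoc (LooseTrans.app φ X) (Modification.app Γ X) (LooseTrans.app ψ X)
  whisker_exchange _ _ := hom_ext fun X => Bicategory.whisker_exchange _ _
  pentagon φ ψ χ θ := by
    refine hom_ext fun X => ?_
    rw [comp_app, comp_app, comp_app, assoc_hom_app, assoc_hom_app, assoc_hom_app]
    refine Eq.trans ?_ (Bicategory.pentagon (LooseTrans.app φ X) (LooseTrans.app ψ X)
      (LooseTrans.app χ X) (LooseTrans.app θ X))
    rw [← assoc_hom_app φ ψ χ, ← assoc_hom_app ψ χ θ]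
    rfl
  triangle φ ψ := by
    refine hom_ext fun X => ?_
    rw [comp_app, assoc_hom_app]
    refine Eq.trans ?_ ((Bicategory.triangle (LooseTrans.app φ X) (LooseTrans.app ψ X)).trans ?_)
    · rw [← id_comp_hom_app ψ]
      rfl
    · rw [← comp_id_hom_app φ]
      rfl

instance : Bicategory.Strict (FunCat w' w S C) where
  id_comp φ := LooseTrans.id_comp φ
  comp_id φ := LooseTrans.comp_id φ
  assoc φ ψ χ := LooseTrans.assoc φ ψ χ
  leftUnitor_eqToIso _ := rfl
  rightUnitor_eqToIso _ := rfl
  associator_eqToIso _ _ _ := rfl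

/-- The `ℱ`-category `Fun_{w', w}(S, C)` of `ℱ`-functors, loose `(w', w)`-natural transformations
and modifications. -/
instance : FCategory (FunCat w' w S C) where
  Tight φ := LooseTrans.IsTight φ
  tight_id _ := ⟨fun _ => FCategory.tight_id _, fun _ => WCell.IsOf.ofEq _ _⟩
  tight_comp _ _ h₁ h₂ := LooseTrans.IsTight.comp h₁ h₂

end FunCat

end Functors

/-! ## The `ℱ`-category of full embeddings -/

/-- The bicategory structure on `A` whose 1-cells and 2-cells are those of `B` between the images
under `F : A → B`. -/
@[reducible]
def inducedBicategory {A : Type u₁} {B : Type u₂} [Bicategory.{w₂, v₂} B] (F : A → B) :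
    Bicategory.{w₂, v₂} A where
  Hom X Y := F X ⟶ F Y
  id X := 𝟙 (F X)
  comp f g := f ≫ g
  homCategory X Y := inferInstanceAs (Category (F X ⟶ F Y))
  whiskerLeft f _ _ η := f ◁ η
  whiskerRight η f := η ▷ f
  associator f g h := α_ f g h
  leftUnitor f := λ_ f
  rightUnitor f := ρ_ f
  whiskerLeft_id _ _ := Bicategory.whiskerLeft_id _ _
  whiskerLeft_comp _ _ _ _ _ _ := Bicategory.whiskerLeft_comp _ _ _
  id_whiskerLeft _ := Bicategory.id_whiskerLeft _
  comp_whiskerLeft _ _ _ _ _ := Bicategory.comp_whiskerLeft _ _ _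
  id_whiskerRight _ _ := Bicategory.id_whiskerRight _ _
  comp_whiskerRight _ _ _ := Bicategory.comp_whiskerRight _ _ _
  whiskerRight_id _ := Bicategory.whiskerRight_id _
  whiskerRight_comp _ _ _ := Bicategory.whiskerRight_comp _ _ _
  whisker_assoc _ _ _ _ _ := Bicategory.whisker_assoc _ _ _
  whisker_exchange _ _ := Bicategory.whisker_exchange _ _
  pentagon _ _ _ _ := Bicategory.pentagon _ _ _ _
  triangle _ _ := Bicategory.triangle _ _

theorem inducedBicategory_strict {A : Type u₁} {B : Type u₂} [Bicategory.{w₂, v₂} B]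
    [Bicategory.Strict B] (F : A → B) :
    @Bicategory.Strict A (inducedBicategory F) :=
  letI := inducedBicategory F
  { id_comp := fun {a b} f => Strict.id_comp (B := B) (a := F a) (b := F b) f
    comp_id := fun {a b} f => Strict.comp_id (B := B) (a := F a) (b := F b) f
    assoc := fun {a b c d} f g h =>
      Strict.assoc (B := B) (a := F a) (b := F b) (c := F c) (d := F d) f g h
    leftUnitor_eqToIso := fun {a b} f =>
      Strict.leftUnitor_eqToIso (B := B) (a := F a) (b := F b) f
    rightUnitor_eqToIso := fun {a b} f =>
      Strict.rightUnitor_eqToIso (B := B) (a := F a) (b := F b) f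
    associator_eqToIso := fun {a b c d} f g h =>
      Strict.associator_eqToIso (B := B) (a := F a) (b := F b) (c := F c) (d := F d) f g h }

/-- An object of `ℱ`: a full embedding of small categories, i.e. a fully faithful functor that is
injective on objects, from the tight part to the loose part. -/
structure FullEmb : Type (u + 1) where
  tight : Cat.{u, u}
  loose : Cat.{u, u}
  incl : tight ⥤ loose
  full : incl.Full
  faithful : incl.Faithful
  injective : Function.Injective incl.obj

/-- The `ℱ`-category `𝔽` of full embeddings: the loose morphisms are functors between the loose
parts, the 2-cells are natural transformations, and a loose morphism is tight when it restricts to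
a functor between the tight parts. -/
instance : FCategory.{u, u, u + 1} FullEmb.{u} where
  toBicategory := inducedBicategory FullEmb.loose
  toStrict := inducedBicategory_strict FullEmb.loose
  Tight {A B} (f : A.loose ⟶ B.loose) :=
    ∃ g : A.tight ⥤ B.tight, g ⋙ B.incl = A.incl ⋙ f.toFunctor
  tight_id A := ⟨𝟭 _, rfl⟩
  tight_comp {A B C} (f : A.loose ⟶ B.loose) (g : B.loose ⟶ C.loose) := by
    rintro ⟨f', hf⟩ ⟨g', hg⟩
    refine ⟨f' ⋙ g', ?_⟩
    change f' ⋙ g' ⋙ C.incl = (A.incl ⋙ f.toFunctor) ⋙ g.toFunctor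
    rw [hg, ← hf]
    rfl

/-- Invertibility of a morphism of `ℱ`, i.e. of a tight morphism of `𝔽`. -/
def FullEmb.IsInvertible {A B : FullEmb.{u}} (f : A ⟶ B) : Prop :=
  FCategory.Tight f ∧ ∃ g : B ⟶ A, FCategory.Tight g ∧ f ≫ g = 𝟙 A ∧ g ≫ f = 𝟙 B

section Strict

variable {B : Type u₁} [Bicategory.{w₁, v₁} B] [Bicategory.Strict B] {X Y Z V : B}

theorem strict_whiskerRight_id {f g : X ⟶ Y} (η : f ⟶ g) :
    η ▷ 𝟙 Y = eqToHom (Strict.comp_id f) ≫ η ≫ eqToHom (Strict.comp_id g).symm := by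
  rw [whiskerRight_id, Strict.rightUnitor_eqToIso, Strict.rightUnitor_eqToIso]
  rfl

theorem strict_whiskerRight_comp {f f' : X ⟶ Y} (η : f ⟶ f') (g : Y ⟶ Z) (h : Z ⟶ V) :
    η ▷ (g ≫ h) = eqToHom (Strict.assoc f g h).symm ≫ η ▷ g ▷ h ≫
      eqToHom (Strict.assoc f' g h) := by
  rw [whiskerRight_comp, Strict.associator_eqToIso, Strict.associator_eqToIso]
  rfl

theorem strict_whiskerLeft_whiskerLeft (f : X ⟶ Y) (g : Y ⟶ Z) {h h' : Z ⟶ V} (η : h ⟶ h') :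
    f ◁ g ◁ η = eqToHom (Strict.assoc f g h).symm ≫ (f ≫ g) ◁ η ≫
      eqToHom (Strict.assoc f g h') := by
  rw [comp_whiskerLeft, Strict.associator_eqToIso, Strict.associator_eqToIso]
  simp

theorem strict_whiskerLeft_whiskerRight (f : X ⟶ Y) {g g' : Y ⟶ Z} (η : g ⟶ g') (h : Z ⟶ V) :
    f ◁ (η ▷ h) = eqToHom (Strict.assoc f g h).symm ≫ (f ◁ η) ▷ h ≫
      eqToHom (Strict.assoc f g' h) := by
  rw [whisker_assoc, Strict.associator_eqToIso, Strict.associator_eqToIso]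
  simp

theorem strict_whiskerLeft_whiskerRight' (f : X ⟶ Y) {g g' : Y ⟶ Z} (η : g ⟶ g') (h : Z ⟶ V) :
    (f ◁ η) ▷ h = eqToHom (Strict.assoc f g h) ≫ f ◁ (η ▷ h) ≫
      eqToHom (Strict.assoc f g' h).symm := by
  rw [whisker_assoc, Strict.associator_eqToIso, Strict.associator_eqToIso]
  simp

theorem strict_whiskerRight_sq {f f' : X ⟶ Y} (η : f ⟶ f') (g : Y ⟶ Z) (h : Z ⟶ V) :
    η ▷ g ▷ h ≫ eqToHom (Strict.assoc f' g h) = eqToHom (Strict.assoc f g h) ≫ η ▷ (g ≫ h) := by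
  rw [whiskerRight_comp, Strict.associator_eqToIso, Strict.associator_eqToIso]
  simp

theorem strict_comp_whiskerLeft_sq (f : X ⟶ Y) (g : Y ⟶ Z) {h h' : Z ⟶ V} (η : h ⟶ h') :
    (f ≫ g) ◁ η ≫ eqToHom (Strict.assoc f g h') =
      eqToHom (Strict.assoc f g h) ≫ f ◁ g ◁ η := by
  rw [comp_whiskerLeft, Strict.associator_eqToIso, Strict.associator_eqToIso]
  simp

end Strict

section Hom

variable {C : Type u₁} [FCategory.{u, u, u₁} C] {E : Type u₂} [FCategory.{u, u, u₂} E]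

/-- The hom-object `C(X, Y)` of an `ℱ`-category. -/
def homObj (X Y : C) : FullEmb.{u} where
  tight := Cat.of (ObjectProperty.FullSubcategory fun f : X ⟶ Y => FCategory.Tight f)
  loose := Cat.of (X ⟶ Y)
  incl := ObjectProperty.ι _
  full := inferInstanceAs (ObjectProperty.ι fun f : X ⟶ Y => FCategory.Tight f).Full
  faithful := inferInstanceAs (ObjectProperty.ι fun f : X ⟶ Y => FCategory.Tight f).Faithful
  injective := fun _ _ h => ObjectProperty.FullSubcategory.ext h

/-- Postcomposition with `g`, as a loose morphism `C(X, Y) ⟶ C(X, Z)` of `𝔽`. -/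
def postcomp (X : C) {Y Z : C} (g : Y ⟶ Z) : homObj X Y ⟶ homObj X Z :=
  Functor.toCatHom
    { obj := fun f : X ⟶ Y => f ≫ g
      map := fun η => η ▷ g
      map_id := fun f => id_whiskerRight f g
      map_comp := fun η θ => comp_whiskerRight η θ g }

/-- Precomposition with `f`, as a loose morphism `C(Y, Z) ⟶ C(X, Z)` of `𝔽`. -/
def precomp {X Y : C} (f : X ⟶ Y) (Z : C) : homObj Y Z ⟶ homObj X Z :=
  Functor.toCatHom
    { obj := fun g : Y ⟶ Z => f ≫ g
      map := fun η => f ◁ η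
      map_id := fun g => whiskerLeft_id f g
      map_comp := fun η θ => whiskerLeft_comp f η θ }

theorem fullEmb_hom_ext {A B : FullEmb.{u}} {f g : A ⟶ B}
    (h : Cat.Hom.toFunctor (C := A.loose) (D := B.loose) f = Cat.Hom.toFunctor g) : f = g :=
  Cat.ext h

theorem fullEmb_hom₂_ext {A B : FullEmb.{u}} {f g : A ⟶ B} {η θ : f ⟶ g}
    (h : ∀ X, (Cat.Hom₂.toNatTrans (C := A.loose) (D := B.loose) η).app X =
      (Cat.Hom₂.toNatTrans θ).app X) : η = θ :=
  Cat.Hom₂.ext (NatTrans.ext (funext h))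

theorem fullEmb_conj_app {A B : FullEmb.{u}} {f f' g' g : A ⟶ B} (h : f = f') (η : f' ⟶ g')
    (h' : g' = g) (X : A.loose) :
    (Cat.Hom₂.toNatTrans (C := A.loose) (D := B.loose) (eqToHom h ≫ η ≫ eqToHom h')).app X =
      eqToHom (congrArg (fun k : A ⟶ B => (Cat.Hom.toFunctor k).obj X) h) ≫
        (Cat.Hom₂.toNatTrans (C := A.loose) (D := B.loose) η).app X ≫
          eqToHom (congrArg (fun k : A ⟶ B => (Cat.Hom.toFunctor k).obj X) h') := by
  subst h; subst h'
  simp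

theorem fullEmb_sq_ext {A B : FullEmb.{u}} {f f' g g' : A ⟶ B} (h : f = g) (h' : f' = g')
    (η : f ⟶ f') (θ : g ⟶ g')
    (e : ∀ X : A.loose, (Cat.Hom₂.toNatTrans (C := A.loose) (D := B.loose) η).app X ≫
        eqToHom (congrArg (fun k : A ⟶ B => (Cat.Hom.toFunctor k).obj X) h') =
      eqToHom (congrArg (fun k : A ⟶ B => (Cat.Hom.toFunctor k).obj X) h) ≫
        (Cat.Hom₂.toNatTrans (C := A.loose) (D := B.loose) θ).app X) :
    η ≫ eqToHom h' = eqToHom h ≫ θ := by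
  subst h; subst h'
  have : η = θ := fullEmb_hom₂_ext fun X => by simpa using e X
  simp [this]

/-- Whiskering with `η`, as a 2-cell of `𝔽`. -/
def postcomp₂ (X : C) {Y Z : C} {g h : Y ⟶ Z} (η : g ⟶ h) : postcomp X g ⟶ postcomp X h :=
  NatTrans.toCatHom₂
    { app := fun f : X ⟶ Y => f ◁ η
      naturality := fun _ _ θ => (whisker_exchange θ η).symm }

theorem postcomp_comp (X : C) {Y Z W : C} (g : Y ⟶ Z) (h : Z ⟶ W) :
    postcomp X (g ≫ h) = postcomp X g ≫ postcomp X h :=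
  fullEmb_hom_ext <| CategoryTheory.Functor.ext (fun f => (Strict.assoc f g h).symm)
    fun _ _ η => strict_whiskerRight_comp η g h

theorem postcomp_precomp {X Y Z W : C} (f : X ⟶ Y) (g : Z ⟶ W) :
    precomp f Z ≫ postcomp X g = postcomp Y g ≫ precomp f W :=
  fullEmb_hom_ext <| CategoryTheory.Functor.ext (fun h => Strict.assoc f h g)
    fun _ _ η => strict_whiskerLeft_whiskerRight' f η g

theorem postcomp₂_precomp {X Y Z W : C} (f : X ⟶ Y) {g g' : Z ⟶ W} (η : g ⟶ g') :
    (precomp f Z ◁ postcomp₂ X η) ≫ eqToHom (postcomp_precomp f g') =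
      eqToHom (postcomp_precomp f g) ≫ (postcomp₂ Y η ▷ precomp f W) :=
  fullEmb_sq_ext (A := homObj Y Z) (B := homObj X W) (postcomp_precomp f g)
    (postcomp_precomp f g') (precomp f Z ◁ postcomp₂ X η) (postcomp₂ Y η ▷ precomp f W)
    fun h => strict_comp_whiskerLeft_sq f h η

/-- The representable `ℱ`-functor `C(X, -)`. -/
def representable (X : C) : FFunctor C FullEmb.{u} where
  obj Y := homObj X Y
  map g := postcomp X g
  map₂ η := postcomp₂ X η
  map₂_id {Y Z} g := fullEmb_hom₂_ext (A := homObj X Y) (B := homObj X Z)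
    fun f => whiskerLeft_id f g
  map₂_comp {Y Z _ _ _} η θ := fullEmb_hom₂_ext (A := homObj X Y) (B := homObj X Z)
    fun f => whiskerLeft_comp f η θ
  map_id _ := fullEmb_hom_ext <| CategoryTheory.Functor.ext (fun f => Strict.comp_id f)
    fun _ _ η => strict_whiskerRight_id η
  map_comp g h := postcomp_comp X g h
  map₂_whisker_left {Y _ W} g h h' η :=
    fullEmb_hom₂_ext (A := homObj X Y) (B := homObj X W) fun f =>
      (strict_whiskerLeft_whiskerLeft f g η).trans
        (fullEmb_conj_app (A := homObj X Y) (B := homObj X W) (postcomp_comp X g h)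
          (postcomp X g ◁ postcomp₂ X η) (postcomp_comp X g h').symm f).symm
  map₂_whisker_right {Y _ W g g'} η h :=
    fullEmb_hom₂_ext (A := homObj X Y) (B := homObj X W) fun f =>
      (strict_whiskerLeft_whiskerRight f η h).trans
        (fullEmb_conj_app (A := homObj X Y) (B := homObj X W) (postcomp_comp X g h)
          (postcomp₂ X η ▷ postcomp X h) (postcomp_comp X g' h).symm f).symm
  map_tight g hg :=
    ⟨ObjectProperty.lift _ (ObjectProperty.ι _ ⋙ (postcomp X g).toFunctor)
      fun f => FCategory.tight_comp _ _ f.2 hg, rfl⟩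

variable {J : Type u} [FCategory.{u, u, u} J]

/-- For `f : A ⟶ X`, the transformation `C(X, D-) ⟶ C(A, D-)` given by precomposition with `f`. -/
def precompTrans (D : FFunctor J C) {A X : C} (f : A ⟶ X) :
    LooseTrans .s .s (D.comp (representable X)) (D.comp (representable A)) where
  app j := precomp f (D.obj j)
  cell g := ⟨⟨postcomp_precomp f (D.map g)⟩⟩
  cell_isOf g _ := ⟨postcomp_precomp f (D.map g), rfl⟩
  naturality η := postcomp₂_precomp f (D.map₂ η)
  cell_id _ := rfl
  cell_comp _ _ := rfl

/-- Whiskering with `η`, as a 2-cell of `𝔽`. -/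
def precomp₂ {X Y : C} {f g : X ⟶ Y} (η : f ⟶ g) (Z : C) : precomp f Z ⟶ precomp g Z :=
  NatTrans.toCatHom₂
    { app := fun h : Y ⟶ Z => η ▷ h
      naturality := fun _ _ θ => whisker_exchange η θ }

theorem precomp₂_postcomp {X Y Z W : C} {f f' : X ⟶ Y} (η : f ⟶ f') (g : Z ⟶ W) :
    (precomp₂ η Z ▷ postcomp X g) ≫ eqToHom (postcomp_precomp f' g) =
      eqToHom (postcomp_precomp f g) ≫ (postcomp Y g ◁ precomp₂ η W) :=
  fullEmb_sq_ext (A := homObj Y Z) (B := homObj X W) (postcomp_precomp f g)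
    (postcomp_precomp f' g) (precomp₂ η Z ▷ postcomp X g) (postcomp Y g ◁ precomp₂ η W)
    fun h => strict_whiskerRight_sq η h g

/-- For `η : f ⟶ f'` with `f f' : A ⟶ X`, the induced modification between the transformations
`C(X, D-) ⟶ C(A, D-)` given by precomposition with `f` and `f'`. -/
def precompModification (D : FFunctor J C) {A X : C} {f f' : A ⟶ X} (η : f ⟶ f') :
    Modification (precompTrans D f) (precompTrans D f') where
  app j := precomp₂ η (D.obj j)
  naturality g := precomp₂_postcomp η (D.map g)

/-- The action `C(X, Y) ⟶ E(GX, GY)` of an `ℱ`-functor `G` on hom-objects. -/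
def homAction (G : FFunctor C E) (X Y : C) : homObj X Y ⟶ homObj (G.obj X) (G.obj Y) :=
  Functor.toCatHom
    { obj := fun f : X ⟶ Y => G.map f
      map := fun η => G.map₂ η
      map_id := fun f => G.map₂_id f
      map_comp := fun η θ => G.map₂_comp η θ }

theorem homAction_postcomp (G : FFunctor C E) (X : C) {Y Z : C} (g : Y ⟶ Z) :
    homAction G X Y ≫ postcomp (G.obj X) (G.map g) = postcomp X g ≫ homAction G X Z :=
  fullEmb_hom_ext <| CategoryTheory.Functor.ext (fun f => (G.map_comp f g).symm)
    fun _ _ η => G.map_whiskerRight η g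

theorem homAction_postcomp₂ (G : FFunctor C E) (X : C) {Y Z : C} {g g' : Y ⟶ Z} (η : g ⟶ g') :
    (homAction G X Y ◁ postcomp₂ (G.obj X) (G.map₂ η)) ≫ eqToHom (homAction_postcomp G X g') =
      eqToHom (homAction_postcomp G X g) ≫ (postcomp₂ X η ▷ homAction G X Z) :=
  fullEmb_sq_ext (A := homObj X Y) (B := homObj (G.obj X) (G.obj Z)) (homAction_postcomp G X g)
    (homAction_postcomp G X g') (homAction G X Y ◁ postcomp₂ (G.obj X) (G.map₂ η))
    (postcomp₂ X η ▷ homAction G X Z) fun f => G.map_whiskerLeft_sq f η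

/-- The action of an `ℱ`-functor `G` on hom-objects, as a transformation
`C(X, D-) ⟶ E(GX, GD-)`. -/
def homActionTrans (G : FFunctor C E) (D : FFunctor J C) (X : C) :
    LooseTrans .s .s (D.comp (representable X)) ((D.comp G).comp (representable (G.obj X))) where
  app j := homAction G X (D.obj j)
  cell g := ⟨⟨homAction_postcomp G X (D.map g)⟩⟩
  cell_isOf g _ := ⟨homAction_postcomp G X (D.map g), rfl⟩
  naturality η := homAction_postcomp₂ G X (D.map₂ η)
  cell_id _ := rfl
  cell_comp _ _ := rfl

theorem homActionTrans_isTight (G : FFunctor C E) (D : FFunctor J C) (X : C) :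
    (homActionTrans G D X).IsTight :=
  ⟨fun j => ⟨ObjectProperty.lift _ (ObjectProperty.ι _ ⋙ (homAction G X (D.obj j)).toFunctor)
      fun f => G.map_tight _ f.2, rfl⟩,
    fun g => ⟨homAction_postcomp G X (D.map g), rfl⟩⟩

end Hom

/-! ## Weighted cones and limits -/

/-- An `ℱ`-weight: an `ℱ`-functor `W : J → 𝔽` with `J` small. -/
structure Weight : Type (u + 1) where
  J : Type u
  [category : FCategory.{u, u, u} J]
  W : FFunctor J FullEmb.{u}

attribute [instance] Weight.category

/-- A weighted cone in `C`: a weight `W : J → 𝔽`, a diagram `D : J → C`, an object `X` of `C`, and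
an `ℱ`-natural transformation `γ : W ⟶ C(X, D-)`, i.e. a tight morphism of `Fun_{s, s}(J, 𝔽)`. -/
structure WeightedCone (C : Type u₁) [FCategory.{u, u, u₁} C] where
  weight : Weight.{u}
  D : FFunctor weight.J C
  X : C
  γ : LooseTrans .s .s weight.W (D.comp (representable X))
  γ_tight : γ.IsTight

namespace WeightedCone

variable {C : Type u₁} [FCategory.{u, u, u₁} C] {E : Type u₂} [FCategory.{u, u, u₂} E]

/-- The image of a weighted cone under an `ℱ`-functor. -/
def map (c : WeightedCone C) (G : FFunctor C E) : WeightedCone E where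
  weight := c.weight
  D := c.D.comp G
  X := G.obj c.X
  γ := c.γ.comp (homActionTrans G c.D c.X)
  γ_tight := c.γ_tight.comp (homActionTrans_isTight G c.D c.X)

/-- The object `[J, 𝔽](W, C(A, D-))` of `ℱ`. -/
def homWeight (c : WeightedCone C) (A : C) : FullEmb.{u} :=
  homObj (FunCat.of .s .s c.weight.W) (FunCat.of .s .s (c.D.comp (representable A)))

/-- The morphism `C(A, X) ⟶ [J, 𝔽](W, C(A, D-))` of `ℱ` induced by a weighted cone. -/
def comparison (c : WeightedCone C) (A : C) : homObj A c.X ⟶ c.homWeight A :=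
  Functor.toCatHom (C := (homObj A c.X).loose) (D := (c.homWeight A).loose)
    { obj := fun f => c.γ.comp (precompTrans c.D f)
      map := fun η => Modification.whiskerLeft c.γ (precompModification c.D η)
      map_id := fun f => by
        refine FunCat.hom_ext fun j => ?_
        refine fullEmb_hom₂_ext (A := c.weight.W.obj j) (B := homObj A (c.D.obj j)) fun y => ?_
        exact id_whiskerRight f (((c.γ.app j).toFunctor.obj y : c.X ⟶ c.D.obj j))
      map_comp := fun η θ => by
        refine FunCat.hom_ext fun j => ?_
        refine fullEmb_hom₂_ext (A := c.weight.W.obj j) (B := homObj A (c.D.obj j)) fun y => ?_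
        exact comp_whiskerRight η θ (((c.γ.app j).toFunctor.obj y : c.X ⟶ c.D.obj j)) }

/-- A weighted cone is a limit cone when the induced morphisms in `ℱ` are invertible. -/
def IsLimit (c : WeightedCone C) : Prop :=
  ∀ A : C, FullEmb.IsInvertible (c.comparison A)

end WeightedCone

/-- An `ℱ`-category is `Ψ`-complete if every diagram has a `W`-weighted limit for each weight `W`
in `Ψ`. -/
def IsComplete (Ψ : Set Weight.{u}) (C : Type u₁) [FCategory.{u, u, u₁} C] : Prop :=
  ∀ W ∈ Ψ, ∀ D : FFunctor W.J C, ∃ (X : C) (γ : LooseTrans .s .s W.W (D.comp (representable X)))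
    (hγ : γ.IsTight), (WeightedCone.mk W D X γ hγ).IsLimit

/-! ## Sketches and their models -/

/-- A limit `ℱ`-sketch on the `ℱ`-category `S`: a class of weighted cones in `S`. -/
structure Sketch (S : Type u) [FCategory.{u, u, u} S] where
  cones : Set (WeightedCone S)

/-- A `Ψ`-limit sketch is one whose cones all have their weights in `Ψ`. -/
def Sketch.IsLimitSketch (Ψ : Set Weight.{u}) {S : Type u} [FCategory.{u, u, u} S]
    (𝒮 : Sketch S) : Prop :=
  ∀ c ∈ 𝒮.cones, c.weight ∈ Ψ

/-- The `Ψ`-limit sketch associated to an `ℱ`-category: its cones are the limit cones whose weights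
are in `Ψ`. -/
def Sketch.ofLimits (Ψ : Set Weight.{u}) (C : Type u) [FCategory.{u, u, u} C] : Sketch C where
  cones := {c | c.weight ∈ Ψ ∧ c.IsLimit}

section Models

variable {S : Type u} [FCategory.{u, u, u} S] {C : Type u} [FCategory.{u, u, u} C]

/-- A model of `𝒮` in `𝒞`: an `ℱ`-functor sending the cones of `𝒮` to cones of `𝒞`. -/
def IsModel (𝒮 : Sketch S) (𝒞 : Sketch C) (M : FFunctor S C) : Prop :=
  ∀ c ∈ 𝒮.cones, c.map M ∈ 𝒞.cones

/-- The underlying type of the `ℱ`-category `Mod_{w', w}(𝒮, 𝒞)`; its objects are models. -/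
def Mod (w' w : Weakness) (𝒮 : Sketch S) (𝒞 : Sketch C) :=
  {M : FunCat w' w S C // IsModel 𝒮 𝒞 M.toFFunctor}

variable {w' w : Weakness} {𝒮 : Sketch S} {𝒞 : Sketch C}

/-- `Mod_{w', w}(𝒮, 𝒞)` is the full sub-`ℱ`-category of `Fun_{w', w}(S, C)` on the models. -/
instance : FCategory.{u, u, u} (Mod w' w 𝒮 𝒞) where
  toBicategory := inducedBicategory (B := FunCat w' w S C) Subtype.val
  toStrict := inducedBicategory_strict (B := FunCat w' w S C) Subtype.val
  Tight φ := LooseTrans.IsTight φ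
  tight_id M := FCategory.tight_id (B := FunCat w' w S C) M.1
  tight_comp _ _ h₁ h₂ := LooseTrans.IsTight.comp h₁ h₂

/-- The evaluation `ℱ`-functor at an object of the sketch. -/
def evaluation (w' w : Weakness) (𝒮 : Sketch S) (𝒞 : Sketch C) (s : S) :
    FFunctor (Mod w' w 𝒮 𝒞) C where
  obj M := M.1.toFFunctor.obj s
  map φ := LooseTrans.app φ s
  map₂ Γ := Modification.app Γ s
  map₂_id _ := rfl
  map₂_comp _ _ := rfl
  map_id _ := rfl
  map_comp _ _ := rfl
  map₂_whisker_left _ _ _ _ := by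
    exact ((Category.id_comp _).trans (Category.comp_id _)).symm
  map₂_whisker_right _ _ := by
    exact ((Category.id_comp _).trans (Category.comp_id _)).symm
  map_tight _ h := h.1 s

end Models

/-- The class `Ψ` of weights is `(w', w)`-created: for each `Ψ`-limit sketch `𝒮` and each
`Ψ`-complete `C`, the `ℱ`-category `Mod_{w', w}(𝒮, C)` is `Ψ`-complete, and the evaluation
`ℱ`-functors preserve and jointly reflect `Ψ`-limits. -/
def IsCreated (Ψ : Set Weight.{u}) (w' w : Weakness) : Prop :=
  ∀ (S : Type u) [FCategory.{u, u, u} S] (𝒮 : Sketch S), 𝒮.IsLimitSketch Ψ →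
    ∀ (C : Type u) [FCategory.{u, u, u} C], IsComplete Ψ C →
      IsComplete Ψ (Mod w' w 𝒮 (Sketch.ofLimits Ψ C)) ∧
      ∀ c : WeightedCone (Mod w' w 𝒮 (Sketch.ofLimits Ψ C)), c.weight ∈ Ψ →
        (c.IsLimit ↔ ∀ s : S, (c.map (evaluation w' w 𝒮 (Sketch.ofLimits Ψ C) s)).IsLimit)

end Enhanced

namespace Enhanced

/-! Write $v=\overline w$ and $v'=\overline{w'}$. An $\mathscr F$-functor $M\colon\mathbb
S\to\mathbf{Mod}_{v',v}(\mathcal T,\mathbb C)$ is a two-variable structure: objects $M(s)(t)$,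
morphisms $M(s)(g)$ and $M(f)_t$, and a $v$-cell $M(f)_g$ in each mixed square. Fixing $t$ and $g$
instead of $s$ and $f$ reflects that square in its diagonal, which exchanges its two composites. The
same 2-cell is then a $w$-cell, as required of a $w$-natural transformation $M(-)(t)\to M(-)(t')$.
This is why the two sides of the isomorphism carry dual weaknesses.

A loose morphism $\varphi\colon M\to N$ has $v$-cells $(\varphi_s)_g$ and, for each $f$, a $w$-cell
$\varphi_f$ between transformations, with components $(\varphi_f)_t$. Transposing keeps both
families and changes only which of them is regarded as belonging to the components. The condition
tying them together is one commuting cube: it says that $(\varphi_f)_t$ is a modification in $t$,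
and equally that $(\varphi_s)_g$ is a modification in $s$. To treat all four weaknesses at once,
`LooseTrans.IsCoherent` states this as an equation of pasted cells. `Mod.isCoherent_component` and
`Mod.ofComponents` identify cells in a category of models with coherent families, and
`Transpose.isCoherent_cell` reads the cube the other way.

Tightness is symmetric as well. A tight $f$ gives a tight $M(f)$, all of whose cells are $v'$-cells,
while a tight $g$ makes every $M(f)_g$ a $v'$-cell; transposition interchanges these two conditions.

All of this is formal and concerns functors into categories of models. Creation enters through the
model conditions. Since evaluations preserve $\Psi$-limits, each $M(-)(t)$ is a model of $\mathcal
S$ (`Transpose.isModel_evalObj`). Since they jointly reflect them, the transpose is a model of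
$\mathcal T$, because each $M(s)$ is one (`Transpose.isModel_functor`). Transposing twice changes
nothing, and completeness follows from applying creation twice. -/

theorem Weakness.dual_dual (w : Weakness) : w.dual.dual = w := by cases w <;> rfl

/-- Duality is carried by hypotheses `v = w.dual` between variables: `w.dual.dual` reduces to `w`
only once `w` is a constructor, and with variables the same constructions serve for both directions
of transposition. -/
theorem Weakness.eq_dual_comm {v w : Weakness} (h : v = w.dual) : w = v.dual := by
  rw [h, w.dual_dual]

/-! ### Reversal of cells -/

namespace WCell

variable {B : Type u₁} [Bicategory.{w₁, v₁} B] {w v w' v' : Weakness} {X Y Z : B}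

/-- Reversing a `w`-cell yields a cell of the dual weakness. -/
def flip (h : v = w.dual) {f g : X ⟶ Y} (x : WCell w f g) : WCell v g f :=
  match v, w, h, x with
  | .s, .s, _, x => ⟨⟨x.down.down.symm⟩⟩
  | .p, .p, _, x => Iso.symm x
  | .c, .l, _, x => x
  | .l, .c, _, x => x

@[simp]
theorem flip_flip (h : v = w.dual) (h' : w = v.dual) {f g : X ⟶ Y} (x : WCell w f g) :
    (x.flip h).flip h' = x := by
  subst h; cases w <;> rfl

@[simp]
theorem flip_ofEq (h : v = w.dual) {f g : X ⟶ Y} (e : f = g) :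
    (ofEq w e).flip h = ofEq v e.symm := by
  subst h; subst e; cases w <;> rfl

@[simp]
theorem flip_comp (h : v = w.dual) {f g k : X ⟶ Y} (x : WCell w f g) (y : WCell w g k) :
    (x.comp y).flip h = (y.flip h).comp (x.flip h) := by
  subst h; cases w <;> rfl

@[simp]
theorem flip_whiskerLeft (h : v = w.dual) (k : X ⟶ Y) {f g : Y ⟶ Z} (x : WCell w f g) :
    (x.whiskerLeft k).flip h = (x.flip h).whiskerLeft k := by
  subst h; cases w <;> rfl

@[simp]
theorem flip_whiskerRight (h : v = w.dual) {f g : X ⟶ Y} (x : WCell w f g) (k : Y ⟶ Z) :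
    (x.whiskerRight k).flip h = (x.flip h).whiskerRight k := by
  subst h; cases w <;> rfl

/-- The reverse of an identity is an identity, and the reverse of an inverse is an inverse of the
reverse; the other two cases carry no condition. -/
theorem IsOf.flip (h' : v' = w'.dual) (h : v = w.dual) {f g : X ⟶ Y} {x : WCell w f g}
    (hx : x.IsOf w') : (x.flip h).IsOf v' := by
  subst h'
  cases w'
  · obtain ⟨e, rfl⟩ := hx
    exact ⟨e.symm, flip_ofEq h e⟩
  · obtain ⟨y, h₁, h₂⟩ := hx
    refine ⟨y.flip h, ?_, ?_⟩
    · rw [← flip_comp, h₂, flip_ofEq]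
    · rw [← flip_comp, h₁, flip_ofEq]
  · trivial
  · trivial

/-- The same square of 2-cells, read from its opposite side. For `l` and `c` the underlying 2-cells
are unchanged and only the equation is turned round; for `p` the inverses have to be moved across.
-/
theorem Compat.flip (h : v = w.dual) {f f' g g' : X ⟶ Y} {a : f ⟶ f'} {b : g ⟶ g'}
    {x : WCell w f g} {y : WCell w f' g'} (c : Compat a b x y) :
    Compat b a (x.flip h) (y.flip h) := by
  subst h; cases w
  · obtain ⟨⟨rfl⟩⟩ := x
    obtain ⟨⟨rfl⟩⟩ := y
    exact ((Category.comp_id _).trans ((Category.id_comp _).symm.trans c.symm)).trans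
      ((Category.comp_id _).trans (Category.id_comp _).symm)
  · change f ≅ g at x
    change f' ≅ g' at y
    change a ≫ Iso.hom y = Iso.hom x ≫ b at c
    change b ≫ Iso.inv y = Iso.inv x ≫ a
    rw [Iso.comp_inv_eq, Category.assoc, Iso.eq_inv_comp, c]
  · exact c.symm
  · exact c.symm

/-- Moving identity cells between the two sides of an equation of pasted cells. -/
theorem move_ofEq {f f' f₁ f₂ f₃ f₄ f₅ g₁ g₂ g₃ g₄ g : X ⟶ Y}
    {x₁ : WCell w f f₁} {p₁ : f₁ = f₂} {x₂ : WCell w f₂ f₃} {p₂ : f₃ = f₄} {x₃ : WCell w f₄ f₅}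
    {p₃ : f₅ = g} {q₀ : f = f'} {y₁ : WCell w f' g₁} {q₁ : g₁ = g₂} {y₂ : WCell w g₂ g₃}
    {q₂ : g₃ = g₄} {y₃ : WCell w g₄ g}
    (e : x₁.comp ((ofEq w p₁).comp (x₂.comp ((ofEq w p₂).comp (x₃.comp (ofEq w p₃))))) =
      (ofEq w q₀).comp (y₁.comp ((ofEq w q₁).comp (y₂.comp ((ofEq w q₂).comp y₃))))) :
    (ofEq w q₀.symm).comp (x₁.comp ((ofEq w p₁).comp (x₂.comp ((ofEq w p₂).comp x₃)))) =
      y₁.comp ((ofEq w q₁).comp (y₂.comp ((ofEq w q₂).comp (y₃.comp (ofEq w p₃.symm))))) := by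
  subst p₃ q₀
  simpa using e

end WCell

/-! ### Extensionality up to heterogeneous equality -/

namespace FFunctor

/-- Heterogeneous because the actions on 1-cells and 2-cells have types that depend on the action on
objects; this avoids transports when transposition is compared with its inverse. -/
theorem hext {B : Type u₁} [FCategory.{w₁, v₁} B] {C : Type u₂} [FCategory.{w₂, v₂} C]
    {F G : FFunctor B C} (hobj : ∀ X, F.obj X = G.obj X)
    (hmap : ∀ {X Y : B} (f : X ⟶ Y), HEq (F.map f) (G.map f))
    (hmap₂ : ∀ {X Y : B} {f g : X ⟶ Y} (η : f ⟶ g), HEq (F.map₂ η) (G.map₂ η)) : F = G := by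
  obtain ⟨⟨⟨⟨⟨obj, map⟩, map₂⟩, _, _⟩, _, _, _, _⟩, _⟩ := F
  obtain ⟨⟨⟨⟨⟨obj', map'⟩, map₂'⟩, _, _⟩, _, _, _, _⟩, _⟩ := G
  obtain rfl : obj = obj' := funext hobj
  obtain rfl : @map = @map' := by
    funext X Y f
    exact eq_of_heq (hmap f)
  obtain rfl : @map₂ = @map₂' := by
    funext X Y f g η
    exact eq_of_heq (hmap₂ η)
  rfl

end FFunctor

theorem LooseTrans.hext {S : Type u₁} [FCategory.{w₁, v₁} S] {C : Type u₂} [FCategory.{w₂, v₂} C]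
    {w' w : Weakness} {F F' G G' : FFunctor S C} (hF : F = F') (hG : G = G')
    {φ : LooseTrans w' w F G} {ψ : LooseTrans w' w F' G'} (happ : ∀ X, HEq (φ.app X) (ψ.app X))
    (hcell : ∀ {X Y : S} (f : X ⟶ Y), HEq (φ.cell f) (ψ.cell f)) : HEq φ ψ := by
  subst hF hG
  obtain ⟨a, c, _, _, _, _⟩ := φ
  obtain ⟨a', c', _, _, _, _⟩ := ψ
  obtain rfl : a = a' := funext fun X => eq_of_heq (happ X)
  obtain rfl : @c = @c' := by
    funext X Y f
    exact eq_of_heq (hcell f)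
  rfl

theorem Modification.hext {S : Type u₁} [FCategory.{w₁, v₁} S] {C : Type u₂}
    [FCategory.{w₂, v₂} C] {w' w : Weakness} {F F' G G' : FFunctor S C} (hF : F = F')
    (hG : G = G') {φ ψ : LooseTrans w' w F G} {φ' ψ' : LooseTrans w' w F' G'} (hφ : HEq φ φ')
    (hψ : HEq ψ ψ') {Γ : Modification φ ψ} {Ξ : Modification φ' ψ'}
    (happ : ∀ X, HEq (Γ.app X) (Ξ.app X)) : HEq Γ Ξ := by
  subst hF hG
  obtain rfl := eq_of_heq hφ
  obtain rfl := eq_of_heq hψ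
  exact heq_of_eq (Modification.ext (funext fun X => eq_of_heq (happ X)))

/-! ### Coherent families of cells -/

namespace LooseTrans

variable {S : Type u₁} [FCategory.{w₁, v₁} S] {C : Type u₂} [FCategory.{w₂, v₂} C]
  {w' w v' v : Weakness} {F G : FFunctor S C}

/-- The type of a structure cell depends on the transformation, so an equation between
transformations cannot simply be rewritten inside it. Here and in `cell_of_eq_comp` the boundary
equalities are free arguments, so that the cell itself can be replaced. -/
theorem cell_of_eq_id {φ : LooseTrans w' w F F} (e : φ = id w' w F) {X Y : S} (f : X ⟶ Y)
    (p : φ.app X ≫ F.map f = F.map f ≫ φ.app Y) : φ.cell f = WCell.ofEq w p := by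
  subst e; rfl

theorem cell_of_eq_comp {H : FFunctor S C} {φ : LooseTrans w' w F H} {ψ : LooseTrans w' w F G}
    {χ : LooseTrans w' w G H} (e : φ = ψ.comp χ) {X Y : S} (f : X ⟶ Y)
    (p : φ.app X ≫ H.map f = ψ.app X ≫ χ.app X ≫ H.map f)
    (q : (F.map f ≫ ψ.app Y) ≫ χ.app Y = F.map f ≫ φ.app Y) :
    φ.cell f = (WCell.ofEq w p).comp
      (((χ.cell f).whiskerLeft (ψ.app X)).comp
        ((WCell.ofEq w (Strict.assoc _ _ _).symm).comp
          (((ψ.cell f).whiskerRight (χ.app Y)).comp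
            (WCell.ofEq w q)))) := by
  subst e; rfl

theorem eq_id {φ : LooseTrans w' w F F} (e : ∀ X, φ.app X = 𝟙 (F.obj X))
    (c : ∀ {X Y : S} (f : X ⟶ Y), φ.cell f = WCell.ofEq w (by
      rw [e, e, Strict.comp_id, Strict.id_comp])) : φ = id w' w F :=
  ext' e fun f => by
    rw [c]
    exact ((congrArg _ (WCell.ofEq_comp_ofEq _ _)).trans (WCell.ofEq_comp_ofEq _ _)).symm

theorem eq_comp {H : FFunctor S C} {φ : LooseTrans w' w F H} {ψ : LooseTrans w' w F G}
    {χ : LooseTrans w' w G H} (e : ∀ X, φ.app X = ψ.app X ≫ χ.app X)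
    (c : ∀ {X Y : S} (f : X ⟶ Y), φ.cell f =
      (WCell.ofEq w (by rw [e, Strict.assoc])).comp
        (((χ.cell f).whiskerLeft (ψ.app X)).comp
          ((WCell.ofEq w (Strict.assoc _ _ _).symm).comp
            (((ψ.cell f).whiskerRight (χ.app Y)).comp
              (WCell.ofEq w (by rw [e, Strict.assoc])))))) : φ = ψ.comp χ :=
  ext' e fun f => by
    rw [c]
    dsimp only [comp]
    simp only [WCell.comp_assoc]
    erw [WCell.ofEq_comp_ofEq_comp, WCell.ofEq_comp_ofEq]

/-- The condition for a family of cells of weakness dual to `w`, between the components of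
`(w', w)`-natural transformations, to form a cell between these transformations. -/
def IsCoherent (h : v = w.dual) (φ ψ : LooseTrans w' w F G)
    (x : ∀ s, WCell v (φ.app s) (ψ.app s)) : Prop :=
  ∀ ⦃s t : S⦄ (f : s ⟶ t),
    ((φ.cell f).flip h).comp ((x s).whiskerRight (G.map f)) =
      ((x t).whiskerLeft (F.map f)).comp ((ψ.cell f).flip h)

/-- Paste `y` onto both ends of the coherence equation for `x`; on each side one pair `x`, `y`
cancels. -/
theorem IsCoherent.symm {h : v = w.dual} {φ ψ : LooseTrans w' w F G}
    {x : ∀ s, WCell v (φ.app s) (ψ.app s)} (c : IsCoherent h φ ψ x)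
    (y : ∀ s, WCell v (ψ.app s) (φ.app s)) (hxy : ∀ s, (x s).comp (y s) = WCell.ofEq v rfl)
    (hyx : ∀ s, (y s).comp (x s) = WCell.ofEq v rfl) : IsCoherent h ψ φ y := by
  intro s t f
  have e := congrArg (fun z => ((y t).whiskerLeft (F.map f)).comp
    (z.comp ((y s).whiskerRight (G.map f)))) (c f)
  simp only [WCell.comp_assoc] at e
  rw [← WCell.comp_whiskerRight, hxy, WCell.whiskerRight_ofEq, WCell.comp_ofEq_rfl,
    ← WCell.comp_assoc ((y t).whiskerLeft _), ← WCell.whiskerLeft_comp, hyx,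
    WCell.whiskerLeft_ofEq, WCell.ofEq_rfl_comp] at e
  exact e.symm

/-- Equal components alone do not identify two transformations. When the family consists of
identities, the coherence equation says exactly that the structure cells also agree, after reversal.
-/
theorem ext_of_isCoherent (h : v = w.dual) {φ ψ : LooseTrans w' w F G}
    (e : ∀ s, φ.app s = ψ.app s) (c : IsCoherent h φ ψ fun s => WCell.ofEq v (e s)) : φ = ψ := by
  refine ext' e fun {s t} f => ?_
  have := congrArg (WCell.flip (Weakness.eq_dual_comm h)) (c f)
  simp only [WCell.flip_comp, WCell.flip_flip, WCell.whiskerLeft_ofEq, WCell.whiskerRight_ofEq,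
    WCell.flip_ofEq] at this
  rw [← this]
  simp

end LooseTrans

/-- For `w = p`, coherence is an equation about the inverses of the structure cells; cancelling them
on both sides gives the modification axiom for the cells themselves. -/
theorem Modification.naturality_inv {S : Type u₁} [FCategory.{w₁, v₁} S] {C : Type u₂}
    [FCategory.{w₂, v₂} C] {w' : Weakness} {F G : FFunctor S C} {φ ψ : LooseTrans w' .p F G}
    {x : ∀ s, WCell .p (φ.app s) (ψ.app s)} (c : LooseTrans.IsCoherent rfl φ ψ x)
    {s t : S} (f : s ⟶ t) :
    WCell.Compat (Iso.hom (x s) ▷ G.map f) (F.map f ◁ Iso.hom (x t)) (φ.cell f) (ψ.cell f) := by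
  have := congrArg Iso.hom (c f)
  change Iso.inv (φ.cell f) ≫ Iso.hom (x s) ▷ _ = _ ◁ Iso.hom (x t) ≫ Iso.inv (ψ.cell f) at this
  change Iso.hom (x s) ▷ _ ≫ Iso.hom (ψ.cell f) = Iso.hom (φ.cell f) ≫ _ ◁ Iso.hom (x t)
  generalize φ.cell f = a at *
  generalize ψ.cell f = b at *
  change _ ≅ _ at a b
  exact (Iso.eq_comp_inv b).1 (((Iso.inv_comp_eq a).1 this).trans (Category.assoc _ _ _).symm)

/-! ### Cells between morphisms of models as coherent families -/

namespace Mod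

variable {S : Type u} [FCategory.{u, u, u} S] {C : Type u} [FCategory.{u, u, u} C]
  {w' w v' v : Weakness} {𝒮 : Sketch S} {𝒞 : Sketch C}

/-- The `ℱ`-functor underlying a model. -/
def functor (M : Mod w' w 𝒮 𝒞) : FFunctor S C := M.1

variable {M N : Mod w' w 𝒮 𝒞}

/-- The transformation underlying a loose morphism of models. -/
def trans (φ : M ⟶ N) : LooseTrans w' w M.functor N.functor := φ

/-- The modification underlying a 2-cell of models. -/
def modification {φ ψ : M ⟶ N} (Γ : φ ⟶ ψ) : Modification (trans φ) (trans ψ) := Γ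

/-- A modification, as a 2-cell of models. -/
def ofModification {φ ψ : M ⟶ N} (Γ : Modification (trans φ) (trans ψ)) : φ ⟶ ψ := Γ

theorem trans_comp {K : Mod w' w 𝒮 𝒞} (φ : M ⟶ N) (ψ : N ⟶ K) :
    trans (φ ≫ ψ) = (trans φ).comp (trans ψ) := rfl

/-- An `ℱ`-functor sending cones to cones, as a model. -/
def of (F : FFunctor S C) (hF : IsModel 𝒮 𝒞 F) : Mod w' w 𝒮 𝒞 := ⟨F, hF⟩

theorem hom₂_ext {φ ψ : M ⟶ N} {Γ Ξ : φ ⟶ ψ}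
    (h : ∀ s, (modification Γ).app s = (modification Ξ).app s) : Γ = Ξ :=
  Modification.ext (funext h)

theorem modification_comp {φ ψ χ : M ⟶ N} (Γ : φ ⟶ ψ) (Ξ : ψ ⟶ χ) (s : S) :
    (modification (Γ ≫ Ξ)).app s = (modification Γ).app s ≫ (modification Ξ).app s := rfl

theorem modification_eqToHom {φ ψ : M ⟶ N} (e : φ = ψ) (s : S) :
    (modification (eqToHom e)).app s = eqToHom (congrArg (fun χ => (trans χ).app s) e) := by
  subst e; rfl

theorem modification_conj {φ φ' ψ' ψ : M ⟶ N} (e : φ = φ') (Γ : φ' ⟶ ψ') (e' : ψ' = ψ) (s : S) :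
    (modification (eqToHom e ≫ Γ ≫ eqToHom e')).app s =
      eqToHom (congrArg (fun χ => (trans χ).app s) e) ≫ (modification Γ).app s ≫
        eqToHom (congrArg (fun χ => (trans χ).app s) e') := by
  rw [modification_comp, modification_comp, modification_eqToHom, modification_eqToHom]

/-- The component at `s` of a cell between transformations of models. -/
def component {φ ψ : M ⟶ N} (x : WCell v φ ψ) (s : S) :
    WCell v ((trans φ).app s) ((trans ψ).app s) :=
  match v, x with
  | .s, x => ⟨⟨congrArg (fun χ => (trans χ).app s) x.down.down⟩⟩
  | .p, x =>
    { hom := (modification (Iso.hom x)).app s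
      inv := (modification (Iso.inv x)).app s
      hom_inv_id := congrArg (fun Γ => (modification Γ).app s) (Iso.hom_inv_id x)
      inv_hom_id := congrArg (fun Γ => (modification Γ).app s) (Iso.inv_hom_id x) }
  | .l, x => Modification.app x s
  | .c, x => Modification.app x s

theorem component_ext {φ ψ : M ⟶ N} {x y : WCell v φ ψ} (h : ∀ s, component x s = component y s) :
    x = y := by
  cases v
  · exact Subsingleton.elim (α := ULift (PLift (φ = ψ))) x y
  · exact Iso.ext (hom₂_ext fun s => congrArg Iso.hom (h s))
  · exact hom₂_ext h
  · exact hom₂_ext h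

theorem component_ofEq {φ ψ : M ⟶ N} (e : φ = ψ) (s : S) :
    component (WCell.ofEq v e) s = WCell.ofEq v (congrArg (fun χ => (trans χ).app s) e) := by
  subst e
  cases v
  · rfl
  · exact Iso.ext rfl
  · rfl
  · rfl

theorem component_comp {φ ψ χ : M ⟶ N} (x : WCell v φ ψ) (y : WCell v ψ χ) (s : S) :
    component (x.comp y) s = (component x s).comp (component y s) := by
  cases v <;> rfl

theorem component_whiskerLeft {K : Mod w' w 𝒮 𝒞} (θ : M ⟶ N) {φ ψ : N ⟶ K} (x : WCell v φ ψ) (s : S) :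
    component (x.whiskerLeft θ) s = (component x s).whiskerLeft ((trans θ).app s) := by
  cases v
  · rfl
  · exact Iso.ext rfl
  · rfl
  · rfl

theorem component_whiskerRight {K : Mod w' w 𝒮 𝒞} {φ ψ : M ⟶ N} (x : WCell v φ ψ) (θ : N ⟶ K) (s : S) :
    component (x.whiskerRight θ) s = (component x s).whiskerRight ((trans θ).app s) := by
  cases v
  · rfl
  · exact Iso.ext rfl
  · rfl
  · rfl

/-- The shape of the pasting in the axiom `cell_comp`. The components of `x` and `y` enter through
separate equations, so that known values can be supplied up to unfolding. `component_comp_cell` does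
the same for the pasting in a composite of transformations. -/
theorem component_pasting {K : Mod w' w 𝒮 𝒞} {φ : M ⟶ K} {φ₁ φ₂ : M ⟶ N} {k : N ⟶ K}
    {L : Mod w' w 𝒮 𝒞} {l : M ⟶ L} {ψ₁ ψ₂ : L ⟶ K} {ψ : M ⟶ K} (p : φ = φ₁ ≫ k)
    (x : WCell v φ₁ φ₂) (q : φ₂ ≫ k = l ≫ ψ₁) (y : WCell v ψ₁ ψ₂) (r : l ≫ ψ₂ = ψ) (s : S)
    {x' : WCell v ((trans φ₁).app s) ((trans φ₂).app s)}
    {y' : WCell v ((trans ψ₁).app s) ((trans ψ₂).app s)}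
    (hx : component x s = x') (hy : component y s = y') :
    component ((WCell.ofEq v p).comp ((x.whiskerRight k).comp
      ((WCell.ofEq v q).comp ((y.whiskerLeft l).comp (WCell.ofEq v r))))) s =
    (WCell.ofEq v (congrArg (fun χ => (trans χ).app s) p)).comp
      ((x'.whiskerRight ((trans k).app s)).comp
        ((WCell.ofEq v (congrArg (fun χ => (trans χ).app s) q)).comp
          ((y'.whiskerLeft ((trans l).app s)).comp
            (WCell.ofEq v (congrArg (fun χ => (trans χ).app s) r))))) := by
  subst hx hy
  simp only [component_comp, component_ofEq, component_whiskerLeft, component_whiskerRight]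
  rfl

theorem component_comp_cell {K : Mod w' w 𝒮 𝒞} {φ : M ⟶ K} {N' : Mod w' w 𝒮 𝒞} {l : M ⟶ N}
    {ψ₁ ψ₂ : N ⟶ K} {φ₁ φ₂ : M ⟶ N'} {k : N' ⟶ K} {ψ : M ⟶ K} (p : φ = l ≫ ψ₁)
    (y : WCell v ψ₁ ψ₂) (q : l ≫ ψ₂ = φ₁ ≫ k) (x : WCell v φ₁ φ₂) (r : φ₂ ≫ k = ψ) (s : S)
    {x' : WCell v ((trans φ₁).app s) ((trans φ₂).app s)}
    {y' : WCell v ((trans ψ₁).app s) ((trans ψ₂).app s)}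
    (hx : component x s = x') (hy : component y s = y') :
    component ((WCell.ofEq v p).comp ((y.whiskerLeft l).comp
      ((WCell.ofEq v q).comp ((x.whiskerRight k).comp (WCell.ofEq v r))))) s =
    (WCell.ofEq v (congrArg (fun χ => (trans χ).app s) p)).comp
      ((y'.whiskerLeft ((trans l).app s)).comp
        ((WCell.ofEq v (congrArg (fun χ => (trans χ).app s) q)).comp
          ((x'.whiskerRight ((trans k).app s)).comp
            (WCell.ofEq v (congrArg (fun χ => (trans χ).app s) r))))) := by
  subst hx hy
  simp only [component_comp, component_ofEq, component_whiskerLeft, component_whiskerRight]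
  rfl

theorem isOf_component {φ ψ : M ⟶ N} {x : WCell v φ ψ} (hx : x.IsOf v') (s : S) :
    (component x s).IsOf v' := by
  cases v'
  · obtain ⟨e, rfl⟩ := hx
    exact ⟨_, component_ofEq e s⟩
  · obtain ⟨y, h₁, h₂⟩ := hx
    refine ⟨component y s, ?_, ?_⟩
    · rw [← component_comp, h₁, component_ofEq]
    · rw [← component_comp, h₂, component_ofEq]
  · trivial
  · trivial

/-- The condition is an equation of 2-cells in every weakness, and 2-cells of models are equal when
their components are. -/
theorem compat_iff {φ φ' ψ ψ' : M ⟶ N} (a : φ ⟶ φ') (b : ψ ⟶ ψ') (x : WCell v φ ψ)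
    (y : WCell v φ' ψ') :
    WCell.Compat a b x y ↔ ∀ s, WCell.Compat ((modification a).app s) ((modification b).app s)
      (component x s) (component y s) := by
  cases v
  · obtain ⟨⟨rfl⟩⟩ := x
    obtain ⟨⟨rfl⟩⟩ := y
    exact ⟨fun h s => congrArg (fun Γ => (modification Γ).app s) h, fun h => hom₂_ext h⟩
  · exact ⟨fun h s => congrArg (fun Γ => (modification Γ).app s) h, fun h => hom₂_ext h⟩
  · exact ⟨fun h s => congrArg (fun Γ => (modification Γ).app s) h, fun h => hom₂_ext h⟩
  · exact ⟨fun h s => congrArg (fun Γ => (modification Γ).app s) h, fun h => hom₂_ext h⟩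

/-- With `v` dual to `w`, coherence is the modification axiom: directly when `v` is `l` or `c`, and
after moving inverses when `v` is `p`. With `ofComponents` as converse, a cell is the same as a
coherent family of components. -/
theorem isCoherent_component (h : v = w.dual) {φ ψ : M ⟶ N} (x : WCell v φ ψ) :
    LooseTrans.IsCoherent h (trans φ) (trans ψ) (component x) := by
  intro s t f
  subst h
  cases w
  · rfl
  · refine Iso.ext ?_
    have := (modification (Iso.hom x)).naturality f
    change _ ▷ _ ≫ Iso.hom ((trans ψ).cell f) = Iso.hom ((trans φ).cell f) ≫ _ at this
    change Iso.inv ((trans φ).cell f) ≫ (modification (Iso.hom x)).app s ▷ _ =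
      _ ◁ (modification (Iso.hom x)).app t ≫ Iso.inv ((trans ψ).cell f)
    generalize (trans φ).cell f = a at *
    generalize (trans ψ).cell f = b at *
    change _ ≅ _ at a b
    exact (Iso.inv_comp_eq a).2 <|
      ((Iso.eq_comp_inv b).2 this).trans (Category.assoc _ _ _)
  · exact (modification x).naturality f
  · exact (modification x).naturality f

/-- The cell between transformations with given components. -/
def ofComponents (h : v = w.dual) {φ ψ : M ⟶ N}
    (x : ∀ s, WCell v ((trans φ).app s) ((trans ψ).app s))
    (c : LooseTrans.IsCoherent h (trans φ) (trans ψ) x) : WCell v φ ψ :=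
  match v, w, h with
  | .s, .s, h => ⟨⟨LooseTrans.ext_of_isCoherent h (fun s => (x s).down.down) c⟩⟩
  | .p, .p, _ =>
    { hom := ofModification
        { app := fun s => Iso.hom (x s)
          naturality := Modification.naturality_inv c }
      inv := ofModification
        { app := fun s => Iso.inv (x s)
          naturality := Modification.naturality_inv
            (LooseTrans.IsCoherent.symm c (fun s => Iso.symm (x s)) (fun s => Iso.self_symm_id (x s))
              fun s => Iso.symm_self_id (x s)) }
      hom_inv_id := hom₂_ext fun s => Iso.hom_inv_id (x s)
      inv_hom_id := hom₂_ext fun s => Iso.inv_hom_id (x s) }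
  -- In the two directed cases the coherence equation unfolds to the modification axiom; a `c`-cell
  -- is a modification from `ψ` to `φ`.
  | .l, .c, _ => (Modification.mk x fun f => c f : Modification (trans φ) (trans ψ))
  | .c, .l, _ => (Modification.mk x fun f => c f : Modification (trans ψ) (trans φ))

@[simp]
theorem component_ofComponents (h : v = w.dual) {φ ψ : M ⟶ N}
    (x : ∀ s, WCell v ((trans φ).app s) ((trans ψ).app s))
    (c : LooseTrans.IsCoherent h (trans φ) (trans ψ) x) (s : S) :
    component (ofComponents h x c) s = x s := by
  subst h
  cases w <;> rfl

/-- Identity components give an identity by `ext_of_isCoherent`. For invertible components, the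
chosen inverses form a coherent family by `IsCoherent.symm`, which assembles to an inverse. -/
theorem isOf_ofComponents (h : v = w.dual) {φ ψ : M ⟶ N}
    {x : ∀ s, WCell v ((trans φ).app s) ((trans ψ).app s)}
    (c : LooseTrans.IsCoherent h (trans φ) (trans ψ) x) (hx : ∀ s, (x s).IsOf v') :
    (ofComponents h x c).IsOf v' := by
  cases v'
  · choose e he using hx
    obtain rfl : x = fun s => WCell.ofEq v (e s) := funext he
    refine ⟨LooseTrans.ext_of_isCoherent h e c, component_ext fun s => ?_⟩
    rw [component_ofComponents, component_ofEq]
  · choose y h₁ h₂ using hx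
    refine ⟨ofComponents h y (c.symm y h₁ h₂), component_ext fun s => ?_,
      component_ext fun s => ?_⟩
    · rw [component_comp, component_ofComponents, component_ofComponents, h₁, component_ofEq]
    · rw [component_comp, component_ofComponents, component_ofComponents, h₂, component_ofEq]
  · trivial
  · trivial

end Mod

/-! ### Transposition of functors -/

namespace Transpose

variable {S : Type u} [FCategory.{u, u, u} S] {T : Type u} [FCategory.{u, u, u} T]
  {C : Type u} [FCategory.{u, u, u} C] {w' w v' v : Weakness} {𝒮 : Sketch S} {𝒯 : Sketch T}
  {𝒞 𝒞' : Sketch C}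

/-- A functor `S → Mod(𝒯, 𝒞)`, evaluated at an object of `T`. -/
def evalObj (M : FFunctor S (Mod v' v 𝒯 𝒞)) (t : T) : FFunctor S C where
  obj s := (M.obj s).functor.obj t
  map f := (Mod.trans (M.map f)).app t
  map₂ σ := (Mod.modification (M.map₂ σ)).app t
  map₂_id := (M.comp (evaluation v' v 𝒯 𝒞 t)).map₂_id
  map₂_comp := (M.comp (evaluation v' v 𝒯 𝒞 t)).map₂_comp
  map_id := (M.comp (evaluation v' v 𝒯 𝒞 t)).map_id
  map_comp := (M.comp (evaluation v' v 𝒯 𝒞 t)).map_comp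
  map₂_whisker_left := (M.comp (evaluation v' v 𝒯 𝒞 t)).map₂_whisker_left
  map₂_whisker_right := (M.comp (evaluation v' v 𝒯 𝒞 t)).map₂_whisker_right
  map_tight := (M.comp (evaluation v' v 𝒯 𝒞 t)).map_tight

theorem trans_map_id (M : FFunctor S (Mod v' v 𝒯 𝒞)) (s : S) :
    Mod.trans (M.map (𝟙 s)) = LooseTrans.id v' v (M.obj s).functor :=
  M.map_id s

theorem trans_map_comp (M : FFunctor S (Mod v' v 𝒯 𝒞)) {s₁ s₂ s₃ : S} (f₁ : s₁ ⟶ s₂)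
    (f₂ : s₂ ⟶ s₃) :
    Mod.trans (M.map (f₁ ≫ f₂)) = (Mod.trans (M.map f₁)).comp (Mod.trans (M.map f₂)) :=
  M.map_comp f₁ f₂

/-- The transformation given by evaluating at a morphism of `T`. -/
def evalMap (h' : w' = v'.dual) (h : w = v.dual) (M : FFunctor S (Mod v' v 𝒯 𝒞)) {t t' : T}
    (g : t ⟶ t') : LooseTrans w' w (evalObj M t) (evalObj M t') where
  app s := (M.obj s).functor.map g
  cell f := ((Mod.trans (M.map f)).cell g).flip h
  -- A tight `f` gives a tight `M.map f`, all of whose cells are `v'`-cells, so `g` need not be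
  -- tight.
  cell_isOf f hf := ((M.map_tight f hf).2 g).flip h' h
  naturality σ := ((Mod.modification (M.map₂ σ)).naturality g).flip h
  cell_id s := by
    have p : (Mod.trans (M.map (𝟙 s))).app t ≫ (M.obj s).functor.map g =
        (M.obj s).functor.map g ≫ (Mod.trans (M.map (𝟙 s))).app t' := by
      rw [trans_map_id, LooseTrans.id, Strict.comp_id, Strict.id_comp]
    rw [LooseTrans.cell_of_eq_id (trans_map_id M s) g p]
    exact WCell.flip_ofEq h _
  cell_comp {s₁ s₂ s₃} f₁ f₂ := by
    rw [LooseTrans.cell_of_eq_comp (trans_map_comp M f₁ f₂) g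
      (by rw [trans_map_comp, LooseTrans.comp, Strict.assoc])
      (by rw [trans_map_comp, LooseTrans.comp, Strict.assoc])]
    simp only [WCell.flip_comp, WCell.flip_ofEq, WCell.comp_assoc, WCell.flip_whiskerLeft,
      WCell.flip_whiskerRight]
    rfl

/-- The roles of the axioms are exchanged: here and in `evalMap_comp`, the cells agree by the unit
and composition axioms of each transformation `M.map f`, whereas the unit and composition axioms of
`evalMap` itself come from functoriality of `M` in `f`. -/
theorem evalMap_id (h' : w' = v'.dual) (h : w = v.dual) (M : FFunctor S (Mod v' v 𝒯 𝒞)) (t : T) :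
    evalMap h' h M (𝟙 t) = LooseTrans.id w' w (evalObj M t) :=
  LooseTrans.eq_id (fun s => (M.obj s).functor.map_id t) fun f => by
    dsimp only [evalMap, evalObj]
    rw [LooseTrans.cell_id, WCell.flip_ofEq]

theorem evalMap_comp (h' : w' = v'.dual) (h : w = v.dual) (M : FFunctor S (Mod v' v 𝒯 𝒞))
    {t₁ t₂ t₃ : T} (g₁ : t₁ ⟶ t₂) (g₂ : t₂ ⟶ t₃) :
    evalMap h' h M (g₁ ≫ g₂) = (evalMap h' h M g₁).comp (evalMap h' h M g₂) :=
  LooseTrans.eq_comp (fun s => (M.obj s).functor.map_comp g₁ g₂) fun f => by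
    dsimp only [evalMap, evalObj]
    rw [LooseTrans.cell_comp]
    simp only [WCell.flip_comp, WCell.flip_ofEq, WCell.comp_assoc, WCell.flip_whiskerLeft,
      WCell.flip_whiskerRight]

/-- The modification given by evaluating at a 2-cell of `T`. -/
def evalMap₂ (h' : w' = v'.dual) (h : w = v.dual) (M : FFunctor S (Mod v' v 𝒯 𝒞)) {t t' : T}
    {g g' : t ⟶ t'} (σ : g ⟶ g') : Modification (evalMap h' h M g) (evalMap h' h M g') where
  app s := (M.obj s).functor.map₂ σ
  naturality f := ((Mod.trans (M.map f)).naturality σ).flip h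

/-- `evalMap`, as a loose morphism of models. -/
def evalHom (h' : w' = v'.dual) (h : w = v.dual) (M : FFunctor S (Mod v' v 𝒯 𝒞))
    (hM : ∀ t, IsModel 𝒮 𝒞' (evalObj M t)) {t t' : T} (g : t ⟶ t') :
    (Mod.of (evalObj M t) (hM t) : Mod w' w 𝒮 𝒞') ⟶ Mod.of (evalObj M t') (hM t') :=
  evalMap h' h M g

theorem evalHom_comp (h' : w' = v'.dual) (h : w = v.dual) (M : FFunctor S (Mod v' v 𝒯 𝒞))
    (hM : ∀ t, IsModel 𝒮 𝒞' (evalObj M t)) {t₁ t₂ t₃ : T} (g₁ : t₁ ⟶ t₂) (g₂ : t₂ ⟶ t₃) :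
    evalHom h' h M hM (g₁ ≫ g₂) = evalHom h' h M hM g₁ ≫ evalHom h' h M hM g₂ :=
  evalMap_comp h' h M g₁ g₂

/-- `evalMap₂`, as a 2-cell of models. -/
def evalHom₂ (h' : w' = v'.dual) (h : w = v.dual) (M : FFunctor S (Mod v' v 𝒯 𝒞))
    (hM : ∀ t, IsModel 𝒮 𝒞' (evalObj M t)) {t t' : T} {g g' : t ⟶ t'} (σ : g ⟶ g') :
    evalHom h' h M hM g ⟶ evalHom h' h M hM g' :=
  evalMap₂ h' h M σ

/-- The transpose `T → Mod(𝒮, 𝒞)` of a functor `S → Mod(𝒯, 𝒞)`. -/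
def functor (h' : w' = v'.dual) (h : w = v.dual) (M : FFunctor S (Mod v' v 𝒯 𝒞))
    (hM : ∀ t, IsModel 𝒮 𝒞' (evalObj M t)) : FFunctor T (Mod w' w 𝒮 𝒞') where
  obj t := Mod.of (evalObj M t) (hM t)
  map g := evalHom h' h M hM g
  map₂ σ := evalHom₂ h' h M hM σ
  map₂_id g := Mod.hom₂_ext fun s => (M.obj s).functor.map₂_id g
  map₂_comp σ τ := Mod.hom₂_ext fun s => (M.obj s).functor.map₂_comp σ τ
  map_id t := evalMap_id h' h M t
  map_comp g₁ g₂ := evalMap_comp h' h M g₁ g₂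
  map₂_whisker_left g g₁ g₂ σ := Mod.hom₂_ext fun s =>
    ((M.obj s).functor.map₂_whisker_left g σ).trans
      (Mod.modification_conj (evalHom_comp h' h M hM g g₁)
        (evalHom h' h M hM g ◁ evalHom₂ h' h M hM σ) (evalHom_comp h' h M hM g g₂).symm s).symm
  map₂_whisker_right {_ _ _ g₁ g₂} σ g := Mod.hom₂_ext fun s =>
    ((M.obj s).functor.map₂_whisker_right σ g).trans
      (Mod.modification_conj (evalHom_comp h' h M hM g₁ g)
        (evalHom₂ h' h M hM σ ▷ evalHom h' h M hM g) (evalHom_comp h' h M hM g₂ g).symm s).symm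
  -- Each `M.map f` is `v'`-natural at the tight `g`, for every `f`; reversed, this is the cell
  -- condition for the transpose of `g` to be tight.
  map_tight g hg := ⟨fun s => (M.obj s).functor.map_tight g hg, fun f =>
    ((Mod.trans (M.map f)).cell_isOf g hg).flip h' h⟩

end Transpose

/-! ### Transposition of transformations and modifications -/

namespace Transpose

variable {S : Type u} [FCategory.{u, u, u} S] {T : Type u} [FCategory.{u, u, u} T]
  {C : Type u} [FCategory.{u, u, u} C] {w' w v' v : Weakness} {𝒮 : Sketch S} {𝒯 : Sketch T}
  {𝒞 𝒞' : Sketch C} {M N K : FFunctor S (Mod v' v 𝒯 𝒞)}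

/-- A transformation between functors `S → Mod(𝒯, 𝒞)`, evaluated at an object of `T`. -/
def evalTrans (φ : LooseTrans w' w M N) (t : T) :
    LooseTrans w' w (evalObj M t) (evalObj N t) where
  app s := (Mod.trans (φ.app s)).app t
  cell f := Mod.component (φ.cell f) t
  cell_isOf f hf := Mod.isOf_component (φ.cell_isOf f hf) t
  naturality σ := (Mod.compat_iff _ _ _ _).1 (φ.naturality σ) t
  cell_id s := by
    rw [φ.cell_id]
    exact Mod.component_ofEq _ t
  cell_comp f g := by
    rw [φ.cell_comp]
    simp only [Mod.component_comp, Mod.component_ofEq, Mod.component_whiskerLeft,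
      Mod.component_whiskerRight]
    rfl

/-- The commuting cube on `f` and `g`. That `φ.cell f` is a cell of models makes its components
coherent at `g`; reversing this equation gives coherence at `f` of the cells at `g` of the
components of `φ`. -/
theorem isCoherent_cell (h : w = v.dual) (h₂ : v = w.dual) (h' : w' = v'.dual)
    (φ : LooseTrans w' w M N)
    {t t' : T} (g : t ⟶ t') :
    LooseTrans.IsCoherent h₂ ((evalTrans φ t).comp (evalMap h' h N g))
      ((evalMap h' h M g).comp (evalTrans φ t'))
      fun s => (Mod.trans (φ.app s)).cell g := by
  intro s s' f
  have := congrArg (WCell.flip h₂) (Mod.isCoherent_component h (φ.cell f) g)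
  dsimp only [evalMap, LooseTrans.comp, evalObj, Mod.trans_comp, evalTrans] at this ⊢
  simp only [WCell.flip_comp, WCell.flip_ofEq, WCell.comp_assoc, WCell.flip_whiskerLeft,
      WCell.flip_whiskerRight, WCell.flip_flip] at this ⊢
  -- The two equations now differ only in the placement of the identity cells that rebracket
  -- composites.
  exact WCell.move_ofEq this

theorem evalTrans_comp (φ : LooseTrans w' w M N) (ψ : LooseTrans w' w N K) (t : T) :
    evalTrans (φ.comp ψ) t = (evalTrans φ t).comp (evalTrans ψ t) :=
  LooseTrans.eq_comp (fun _ => rfl) fun f => by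
    dsimp only [evalTrans, LooseTrans.comp]
    simp only [Mod.component_comp, Mod.component_ofEq, Mod.component_whiskerLeft,
      Mod.component_whiskerRight]
    rfl

theorem evalTrans_id (M : FFunctor S (Mod v' v 𝒯 𝒞)) (t : T) :
    evalTrans (LooseTrans.id w' w M) t = LooseTrans.id w' w (evalObj M t) :=
  LooseTrans.eq_id (fun _ => rfl) fun _ => Mod.component_ofEq _ t

section

variable (h' : w' = v'.dual) (h : w = v.dual) (h₂ : v = w.dual)
  (hM : ∀ t : T, IsModel 𝒮 𝒞' (evalObj M t)) (hN : ∀ t : T, IsModel 𝒮 𝒞' (evalObj N t))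

/-- `evalTrans`, as a loose morphism of models. -/
def transApp (φ : LooseTrans w' w M N) (t : T) :
    (functor h' h M hM).obj t ⟶ (functor h' h N hN).obj t :=
  evalTrans φ t

/-- The structure cells of the transpose of a transformation. -/
def transCell (φ : LooseTrans w' w M N) {t t' : T} (g : t ⟶ t') :
    WCell v (transApp h' h hM hN φ t ≫ (functor h' h N hN).map g)
      ((functor h' h M hM).map g ≫ transApp h' h hM hN φ t') :=
  Mod.ofComponents h₂ (fun s => (Mod.trans (φ.app s)).cell g) (isCoherent_cell h h₂ h' φ g)

theorem component_transCell (φ : LooseTrans w' w M N) {t t' : T} (g : t ⟶ t') (s : S) :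
    Mod.component (transCell h' h h₂ hM hN φ g) s = (Mod.trans (φ.app s)).cell g :=
  Mod.component_ofComponents _ _ _ s

theorem isOf_transCell {φ : LooseTrans w' w M N} {t t' : T} {g : t ⟶ t'}
    (hg : ∀ s, ((Mod.trans (φ.app s)).cell g).IsOf v') :
    (transCell h' h h₂ hM hN φ g).IsOf v' :=
  Mod.isOf_ofComponents _ _ hg

theorem compat_transCell {φ ψ : LooseTrans w' w M N} {t t' : T} {g g' : t ⟶ t'}
    {a : transApp h' h hM hN φ t ≫ (functor h' h N hN).map g ⟶
      transApp h' h hM hN ψ t ≫ (functor h' h N hN).map g'}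
    {b : (functor h' h M hM).map g ≫ transApp h' h hM hN φ t' ⟶
      (functor h' h M hM).map g' ≫ transApp h' h hM hN ψ t'}
    (hab : ∀ s, WCell.Compat ((Mod.modification a).app s) ((Mod.modification b).app s)
      ((Mod.trans (φ.app s)).cell g) ((Mod.trans (ψ.app s)).cell g')) :
    WCell.Compat a b (transCell h' h h₂ hM hN φ g) (transCell h' h h₂ hM hN ψ g') :=
  (Mod.compat_iff _ _ _ _).2 fun s => by
    rw [component_transCell, component_transCell]
    exact hab s

/-- The transpose of a transformation between functors `S → Mod(𝒯, 𝒞)`. -/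
def trans (φ : LooseTrans w' w M N) :
    LooseTrans v' v (functor h' h M hM) (functor h' h N hN) where
  app t := transApp h' h hM hN φ t
  cell g := transCell h' h h₂ hM hN φ g
  cell_isOf g hg := isOf_transCell h' h h₂ hM hN fun s => (Mod.trans (φ.app s)).cell_isOf g hg
  naturality σ := compat_transCell h' h h₂ hM hN fun s => (Mod.trans (φ.app s)).naturality σ
  -- At each `s` this axiom and the next reduce to those of the transformation `φ.app s`.
  cell_id t := Mod.component_ext fun s => by
    refine (component_transCell h' h h₂ hM hN φ (𝟙 t) s).trans
      (((Mod.trans (φ.app s)).cell_id t).trans ?_)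
    symm
    exact Mod.component_ofEq _ s
  cell_comp g₁ g₂ := Mod.component_ext fun s => by
    refine (component_transCell h' h h₂ hM hN φ (g₁ ≫ g₂) s).trans
      (((Mod.trans (φ.app s)).cell_comp g₁ g₂).trans ?_)
    symm
    exact Mod.component_pasting _ (transCell h' h h₂ hM hN φ g₁) _
      (transCell h' h h₂ hM hN φ g₂) _ s (component_transCell h' h h₂ hM hN φ g₁ s)
      (component_transCell h' h h₂ hM hN φ g₂ s)

/-- Tightness of `φ` says that all `φ.app s` are tight and all `φ.cell f` are `w'`-cells. The second
condition, taken componentwise, helps make the new components tight, and the cells of the `φ.app s`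
make the new structure cells `v'`-cells. -/
theorem trans_isTight {φ : LooseTrans w' w M N} (hφ : φ.IsTight) :
    (trans h' h h₂ hM hN φ).IsTight :=
  ⟨fun t => ⟨fun s => (hφ.1 s).1 t, fun f => Mod.isOf_component (hφ.2 f) t⟩,
    fun g => isOf_transCell h' h h₂ hM hN fun s => (hφ.1 s).2 g⟩

/-- A modification between functors to models, evaluated at an object. -/
def modificationApp {φ ψ : LooseTrans w' w M N} (Γ : Modification φ ψ) (t : T) :
    transApp h' h hM hN φ t ⟶ transApp h' h hM hN ψ t :=
  ({ app := fun s => (Mod.modification (Γ.app s)).app t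
     naturality := fun f => (Mod.compat_iff _ _ _ _).1 (Γ.naturality f) t } :
    Modification (evalTrans φ t) (evalTrans ψ t))

/-- The transpose of a modification. -/
def modification {φ ψ : LooseTrans w' w M N} (Γ : Modification φ ψ) :
    Modification (trans h' h h₂ hM hN φ) (trans h' h h₂ hM hN ψ) where
  app t := modificationApp h' h hM hN Γ t
  naturality g := compat_transCell h' h h₂ hM hN (φ := φ) (ψ := ψ) fun s =>
    (Mod.modification (Γ.app s)).naturality g

end

end Transpose

/-! ### Images of cones and the model conditions -/

/-- Cells of weakness `s` are proofs of equality, so only the components need comparing, and these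
agree by definition. -/
theorem homActionTrans_comp {J C D E : Type u} [FCategory.{u, u, u} J] [FCategory.{u, u, u} C]
    [FCategory.{u, u, u} D] [FCategory.{u, u, u} E] (F : FFunctor C D) (G : FFunctor D E)
    (A : FFunctor J C) (X : C) :
    (homActionTrans F A X).comp (homActionTrans G (A.comp F) (F.obj X)) =
      homActionTrans (F.comp G) A X :=
  LooseTrans.ext' (fun _ => rfl) fun _ =>
    Subsingleton.elim (α := ULift (PLift _)) _ _

namespace WeightedCone

variable {C D E : Type u} [FCategory.{u, u, u} C] [FCategory.{u, u, u} D] [FCategory.{u, u, u} E]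

/-- Used to recognise the evaluation of the image of a cone under `M` as its image under an
evaluated functor. -/
theorem map_map (c : WeightedCone C) (F : FFunctor C D) (G : FFunctor D E) :
    (c.map F).map G = c.map (F.comp G) := by
  have e : (c.γ.comp (homActionTrans F c.D c.X)).comp
      (homActionTrans G (c.D.comp F) (F.obj c.X)) = c.γ.comp (homActionTrans (F.comp G) c.D c.X) :=
    (LooseTrans.assoc _ _ _).trans (congrArg _ (homActionTrans_comp F G c.D c.X))
  change WeightedCone.mk _ _ _ _ _ = WeightedCone.mk _ _ _ _ _
  congr 1

end WeightedCone

namespace Transpose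

variable {S : Type u} [FCategory.{u, u, u} S] {T : Type u} [FCategory.{u, u, u} T]
  {C : Type u} [FCategory.{u, u, u} C] {w' w v' v : Weakness} {𝒮 : Sketch S} {𝒯 : Sketch T}

section

variable {Ψ : Set Weight.{u}}

/-- Preservation half of creation: `M` sends a cone of `𝒮` to a limit cone of models of `𝒯`, and
evaluation at `t` keeps it a limit cone. -/
theorem isModel_evalObj (hΨ : IsCreated Ψ v' v) (h𝒯 : 𝒯.IsLimitSketch Ψ) (hC : IsComplete Ψ C)
    {M : FFunctor S (Mod v' v 𝒯 (Sketch.ofLimits Ψ C))}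
    (hM : IsModel 𝒮 (Sketch.ofLimits Ψ (Mod v' v 𝒯 (Sketch.ofLimits Ψ C))) M) (t : T) :
    IsModel 𝒮 (Sketch.ofLimits Ψ C) (evalObj M t) := by
  intro c hc
  obtain ⟨h₁, h₂⟩ := hM c hc
  refine ⟨h₁, ?_⟩
  have := ((hΨ T 𝒯 h𝒯 C hC).2 (c.map M) h₁).1 h₂ t
  rw [WeightedCone.map_map] at this
  exact this

/-- Joint reflection half of creation: the image of a cone of `𝒯` is a limit cone of models of `𝒮`
as soon as all of its evaluations are. -/
theorem isModel_functor (hΨ : IsCreated Ψ w' w) (h𝒮 : 𝒮.IsLimitSketch Ψ) (h𝒯 : 𝒯.IsLimitSketch Ψ)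
    (hC : IsComplete Ψ C) (h' : w' = v'.dual) (h : w = v.dual)
    {M : FFunctor S (Mod v' v 𝒯 (Sketch.ofLimits Ψ C))}
    (hM : ∀ t, IsModel 𝒮 (Sketch.ofLimits Ψ C) (evalObj M t)) :
    IsModel 𝒯 (Sketch.ofLimits Ψ (Mod w' w 𝒮 (Sketch.ofLimits Ψ C))) (functor h' h M hM) := by
  intro c hc
  refine ⟨h𝒯 c hc, ((hΨ S 𝒮 h𝒮 C hC).2 _ (h𝒯 c hc)).2 fun s => ?_⟩
  rw [WeightedCone.map_map]
  -- The transpose evaluated at `s` is `M.obj s` by definition, and this is a model of `𝒯`.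
  exact ((M.obj s).2 c hc).2

end

variable {𝒞 𝒞' : Sketch C} (h' : w' = v'.dual) (h : w = v.dual) (h₂ : v = w.dual)

theorem trans_id {M : FFunctor S (Mod v' v 𝒯 𝒞)} (hM : ∀ t : T, IsModel 𝒮 𝒞' (evalObj M t)) :
    trans h' h h₂ hM hM (LooseTrans.id w' w M) =
      LooseTrans.id v' v (functor h' h M hM) :=
  LooseTrans.eq_id (fun t => evalTrans_id M t) fun g => Mod.component_ext fun s => by
    refine (component_transCell h' h h₂ hM hM (LooseTrans.id w' w M) g s).trans ?_
    symm
    exact Mod.component_ofEq _ s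

theorem trans_comp {M N K : FFunctor S (Mod v' v 𝒯 𝒞)}
    (hM : ∀ t : T, IsModel 𝒮 𝒞' (evalObj M t)) (hN : ∀ t : T, IsModel 𝒮 𝒞' (evalObj N t))
    (hK : ∀ t : T, IsModel 𝒮 𝒞' (evalObj K t)) (φ : LooseTrans w' w M N)
    (ψ : LooseTrans w' w N K) :
    trans h' h h₂ hM hK (φ.comp ψ) =
      (trans h' h h₂ hM hN φ).comp (trans h' h h₂ hN hK ψ) :=
  LooseTrans.eq_comp (fun t => evalTrans_comp φ ψ t) fun g => Mod.component_ext fun s => by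
    refine (component_transCell h' h h₂ hM hK (φ.comp ψ) g s).trans ?_
    symm
    exact Mod.component_comp_cell _ (transCell h' h h₂ hN hK ψ g) _ (transCell h' h h₂ hM hN φ g)
      _ s (component_transCell h' h h₂ hM hN φ g s) (component_transCell h' h h₂ hN hK ψ g s)

/-! ### Transposition between the two iterated categories of models -/

section

variable {𝒟 : Sketch (Mod v' v 𝒯 𝒞)} {𝒟' : Sketch (Mod w' w 𝒮 𝒞')}
  (P : ∀ M : Mod w' w 𝒮 𝒟, ∀ t, IsModel 𝒮 𝒞' (evalObj M.functor t))
  (Q : ∀ M : Mod w' w 𝒮 𝒟, IsModel 𝒯 𝒟' (functor h' h M.functor (P M)))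

/-- Transposition `Mod(𝒮, Mod(𝒯, 𝒞)) → Mod(𝒯, Mod(𝒮, 𝒞))` on loose morphisms. -/
def modMap {M N : Mod w' w 𝒮 𝒟} (φ : M ⟶ N) :
    (Mod.of (functor h' h M.functor (P M)) (Q M) : Mod v' v 𝒯 𝒟') ⟶
      Mod.of (functor h' h N.functor (P N)) (Q N) :=
  trans h' h h₂ (P M) (P N) (Mod.trans φ)

theorem modMap_comp {M N K : Mod w' w 𝒮 𝒟} (φ : M ⟶ N) (ψ : N ⟶ K) :
    modMap h' h h₂ P Q (φ ≫ ψ) = modMap h' h h₂ P Q φ ≫ modMap h' h h₂ P Q ψ :=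
  trans_comp h' h h₂ (P M) (P N) (P K) (Mod.trans φ) (Mod.trans ψ)

/-- Transposition `Mod(𝒮, Mod(𝒯, 𝒞)) → Mod(𝒯, Mod(𝒮, 𝒞))` on 2-cells. -/
def modMap₂ {M N : Mod w' w 𝒮 𝒟} {φ ψ : M ⟶ N} (Γ : φ ⟶ ψ) :
    modMap h' h h₂ P Q φ ⟶ modMap h' h h₂ P Q ψ :=
  modification h' h h₂ (P M) (P N) (Mod.modification Γ)

/-- Transposition, as an `ℱ`-functor `Mod(𝒮, Mod(𝒯, 𝒞)) → Mod(𝒯, Mod(𝒮, 𝒞))`. -/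
def modFunctor : FFunctor (Mod w' w 𝒮 𝒟) (Mod v' v 𝒯 𝒟') where
  obj M := Mod.of (functor h' h M.functor (P M)) (Q M)
  map φ := modMap h' h h₂ P Q φ
  map₂ Γ := modMap₂ h' h h₂ P Q Γ
  map₂_id _ := rfl
  map₂_comp _ _ := rfl
  map_id M := trans_id h' h h₂ (P M)
  map_comp φ ψ := modMap_comp h' h h₂ P Q φ ψ
  map₂_whisker_left {M N K} φ ψ ψ' Γ := Mod.hom₂_ext fun t => by
    refine Eq.trans ?_ (Mod.modification_conj (modMap_comp h' h h₂ P Q φ ψ)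
      (modMap h' h h₂ P Q φ ◁ modMap₂ h' h h₂ P Q Γ) (modMap_comp h' h h₂ P Q φ ψ').symm t).symm
    refine Mod.hom₂_ext fun s => ?_
    refine Eq.trans ?_ (Mod.modification_conj _ _ _ s).symm
    -- At fixed `t` and `s` the composites on both sides coincide by definition, so the transports
    -- of the boundary are identity 2-cells.
    exact ((Category.id_comp _).trans (Category.comp_id _)).symm
  map₂_whisker_right {M N K φ φ'} Γ ψ := Mod.hom₂_ext fun t => by
    refine Eq.trans ?_ (Mod.modification_conj (modMap_comp h' h h₂ P Q φ ψ)
      (modMap₂ h' h h₂ P Q Γ ▷ modMap h' h h₂ P Q ψ) (modMap_comp h' h h₂ P Q φ' ψ).symm t).symm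
    refine Mod.hom₂_ext fun s => ?_
    refine Eq.trans ?_ (Mod.modification_conj _ _ _ s).symm
    exact ((Category.id_comp _).trans (Category.comp_id _)).symm
  map_tight φ hφ := trans_isTight h' h h₂ _ _ hφ

end

end Transpose

/-! ### Transposing twice is the identity -/

namespace Transpose

variable {S : Type u} [FCategory.{u, u, u} S] {T : Type u} [FCategory.{u, u, u} T]
  {C : Type u} [FCategory.{u, u, u} C] {w' w v' v : Weakness} {𝒮 : Sketch S} {𝒯 : Sketch T}

section

variable {𝒞 𝒞' : Sketch C} (h' : w' = v'.dual) (h : w = v.dual) (h₂' : v' = w'.dual)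
  (h₂ : v = w.dual) {M N : FFunctor S (Mod v' v 𝒯 𝒞)} (hM : ∀ t, IsModel 𝒮 𝒞' (evalObj M t))
  (hN : ∀ t, IsModel 𝒮 𝒞' (evalObj N t))
  (hM' : ∀ s, IsModel 𝒯 𝒞 (evalObj (functor (𝒮 := 𝒮) h' h M hM) s))
  (hN' : ∀ s, IsModel 𝒯 𝒞 (evalObj (functor (𝒮 := 𝒮) h' h N hN) s))

/-- Each cell has been reversed twice, which is the identity by computation once the weakness is a
constructor; the case split serves only to expose this. -/
theorem evalMap_functor {s s' : S} (f : s ⟶ s') :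
    evalMap h₂' h₂ (functor (𝒮 := 𝒮) h' h M hM) f = Mod.trans (M.map f) := by
  subst h₂
  cases w <;> rfl

/-- On objects the equality is eta for structures: each model is rebuilt from its own data. -/
theorem functor_functor : functor h₂' h₂ (functor (𝒮 := 𝒮) h' h M hM) hM' = M :=
  FFunctor.hext (fun _ => rfl) (fun f => heq_of_eq (evalMap_functor h' h h₂' h₂ hM f)) fun η => by
    subst h₂
    cases w <;> exact HEq.rfl

theorem evalTrans_trans (φ : LooseTrans w' w M N) (s : S) :
    evalTrans (trans h' h h₂ hM hN φ) s = Mod.trans (φ.app s) :=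
  LooseTrans.ext' (fun _ => rfl) fun g => by
    refine (component_transCell h' h h₂ hM hN φ g s).trans ?_
    symm
    exact (WCell.ofEq_rfl_comp rfl _).trans (WCell.comp_ofEq_rfl rfl _)

theorem transCell_transCell (φ : LooseTrans w' w M N) {s s' : S} (f : s ⟶ s') :
    HEq (transCell h₂' h₂ h hM' hN' (trans h' h h₂ hM hN φ) f) (φ.cell f) := by
  subst h₂
  cases w <;> exact HEq.rfl

/-- Heterogeneous because the endpoints are recovered only up to the propositional equality
`functor_functor`. -/
theorem trans_trans (φ : LooseTrans w' w M N) :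
    HEq (trans h₂' h₂ h hM' hN' (trans h' h h₂ hM hN φ)) φ :=
  LooseTrans.hext (functor_functor h' h h₂' h₂ hM hM') (functor_functor h' h h₂' h₂ hN hN')
    (fun s => heq_of_eq (evalTrans_trans h' h h₂ hM hN φ s))
    fun f => transCell_transCell h' h h₂' h₂ hM hN hM' hN' φ f

theorem modification_modification {φ ψ : LooseTrans w' w M N} (Γ : Modification φ ψ) :
    HEq (modification h₂' h₂ h hM' hN' (modification h' h h₂ hM hN Γ)) Γ :=
  Modification.hext (functor_functor h' h h₂' h₂ hM hM') (functor_functor h' h h₂' h₂ hN hN')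
    (trans_trans h' h h₂' h₂ hM hN hM' hN' φ) (trans_trans h' h h₂' h₂ hM hN hM' hN' ψ) fun s =>
      Modification.hext rfl rfl (heq_of_eq (evalTrans_trans h' h h₂ hM hN φ s))
        (heq_of_eq (evalTrans_trans h' h h₂ hM hN ψ s)) fun _ => HEq.rfl

end

variable {𝒞 𝒞' : Sketch C} (h' : w' = v'.dual) (h : w = v.dual) (h₂' : v' = w'.dual)
  (h₂ : v = w.dual) {𝒟 : Sketch (Mod v' v 𝒯 𝒞)} {𝒟' : Sketch (Mod w' w 𝒮 𝒞')}
  (P : ∀ M : Mod w' w 𝒮 𝒟, ∀ t, IsModel 𝒮 𝒞' (evalObj M.functor t))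
  (Q : ∀ M : Mod w' w 𝒮 𝒟, IsModel 𝒯 𝒟' (functor h' h M.functor (P M)))
  (P' : ∀ M : Mod v' v 𝒯 𝒟', ∀ s, IsModel 𝒯 𝒞 (evalObj M.functor s))
  (Q' : ∀ M : Mod v' v 𝒯 𝒟', IsModel 𝒮 𝒟 (functor h₂' h₂ M.functor (P' M)))

theorem modFunctor_obj (M : Mod w' w 𝒮 𝒟) :
    (modFunctor h₂' h₂ h P' Q').obj ((modFunctor h' h h₂ P Q).obj M) = M :=
  Subtype.ext (functor_functor h' h h₂' h₂ (P M) (P' (Mod.of _ (Q M))))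

theorem modFunctor_map {M N : Mod w' w 𝒮 𝒟} (φ : M ⟶ N) :
    HEq ((modFunctor h₂' h₂ h P' Q').map ((modFunctor h' h h₂ P Q).map φ)) φ :=
  trans_trans h' h h₂' h₂ (P M) (P N) (P' (Mod.of _ (Q M))) (P' (Mod.of _ (Q N))) (Mod.trans φ)

theorem modFunctor_map₂ {M N : Mod w' w 𝒮 𝒟} {φ ψ : M ⟶ N} (Γ : φ ⟶ ψ) :
    HEq ((modFunctor h₂' h₂ h P' Q').map₂ ((modFunctor h' h h₂ P Q).map₂ Γ)) Γ :=
  modification_modification h' h h₂' h₂ (P M) (P N) (P' (Mod.of _ (Q M))) (P' (Mod.of _ (Q N)))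
    (Mod.modification Γ)

theorem modFunctor_modFunctor :
    (modFunctor h' h h₂ P Q).comp (modFunctor h₂' h₂ h P' Q') = FFunctor.id (Mod w' w 𝒮 𝒟) :=
  FFunctor.hext (modFunctor_obj h' h h₂' h₂ P Q P' Q') (modFunctor_map h' h h₂' h₂ P Q P' Q')
    (modFunctor_map₂ h' h h₂' h₂ P Q P' Q')

end Transpose

end Enhanced

/-! ### The theorem -/

theorem mainTheorem1 (w' w : Enhanced.Weakness) (hw : w' ≤ w) (Ψ : Set Enhanced.Weight.{u})
    (hΨ : Enhanced.IsCreated Ψ w' w) (hΨ' : Enhanced.IsCreated Ψ w'.dual w.dual)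
    {S : Type u} [Enhanced.FCategory.{u, u, u} S] (𝒮 : Enhanced.Sketch S)
    (h𝒮 : 𝒮.IsLimitSketch Ψ)
    {T : Type u} [Enhanced.FCategory.{u, u, u} T] (𝒯 : Enhanced.Sketch T)
    (h𝒯 : 𝒯.IsLimitSketch Ψ)
    (C : Type u) [Enhanced.FCategory.{u, u, u} C] (hC : Enhanced.IsComplete Ψ C) :
    Enhanced.IsComplete Ψ
        (Enhanced.Mod w' w 𝒮 (Enhanced.Sketch.ofLimits Ψ
          (Enhanced.Mod w'.dual w.dual 𝒯 (Enhanced.Sketch.ofLimits Ψ C)))) ∧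
      Enhanced.IsComplete Ψ
        (Enhanced.Mod w'.dual w.dual 𝒯 (Enhanced.Sketch.ofLimits Ψ
          (Enhanced.Mod w' w 𝒮 (Enhanced.Sketch.ofLimits Ψ C)))) ∧
      Nonempty (Enhanced.FIso
        (Enhanced.Mod w' w 𝒮 (Enhanced.Sketch.ofLimits Ψ
          (Enhanced.Mod w'.dual w.dual 𝒯 (Enhanced.Sketch.ofLimits Ψ C))))
        (Enhanced.Mod w'.dual w.dual 𝒯 (Enhanced.Sketch.ofLimits Ψ
          (Enhanced.Mod w' w 𝒮 (Enhanced.Sketch.ofLimits Ψ C))))) := by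
  have d' : w' = w'.dual.dual := w'.dual_dual.symm
  have d : w = w.dual.dual := w.dual_dual.symm
  -- Creation for one pair of weaknesses makes the inner category of models complete, so that
  -- creation for the dual pair applies to the outer one.
  refine ⟨(hΨ S 𝒮 h𝒮 _ (hΨ' T 𝒯 h𝒯 C hC).1).1, (hΨ' T 𝒯 h𝒯 _ (hΨ S 𝒮 h𝒮 C hC).1).1, ⟨?_⟩⟩
  have P (M : Enhanced.Mod w' w 𝒮 (Enhanced.Sketch.ofLimits Ψ
      (Enhanced.Mod w'.dual w.dual 𝒯 (Enhanced.Sketch.ofLimits Ψ C)))) :=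
    Enhanced.Transpose.isModel_evalObj hΨ' h𝒯 hC M.2
  have P' (M : Enhanced.Mod w'.dual w.dual 𝒯 (Enhanced.Sketch.ofLimits Ψ
      (Enhanced.Mod w' w 𝒮 (Enhanced.Sketch.ofLimits Ψ C)))) :=
    Enhanced.Transpose.isModel_evalObj hΨ h𝒮 hC M.2
  have Q (M) := Enhanced.Transpose.isModel_functor hΨ h𝒮 h𝒯 hC d' d (P M)
  have Q' (M) := Enhanced.Transpose.isModel_functor hΨ' h𝒯 h𝒮 hC rfl rfl (P' M)
  -- The inverse is the same transposition with the two sketches and the two pairs of weaknesses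
  -- exchanged, so both identities are instances of `modFunctor_modFunctor`.
  exact
    { hom := Enhanced.Transpose.modFunctor d' d rfl P Q
      inv := Enhanced.Transpose.modFunctor rfl rfl d P' Q'
      hom_inv_id := Enhanced.Transpose.modFunctor_modFunctor d' d rfl rfl P Q P' Q'
      inv_hom_id := Enhanced.Transpose.modFunctor_modFunctor rfl rfl d' d P' Q' P Q }
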